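/- **Notation.** Let $I$ be a finite poset with $n$ elements. Its incidence matrix is $C_I\in M_n(\mathbb Z)$ with $(i,j)$ entry $1$ if $i\preceq j$ and $0$ otherwise; $G_I=\frac12(C_I+C_I^{tr})$ is its symmetric Gram matrix, $q_I(x)=x\,C_I\,x^{tr}$ (for row vectors $x\in\mathbb Z^n$) its quadratic form, and $\operatorname{Ker}q_I=\{v\in\mathbb Z^n: q_I(v)=0\}$. The Coxeter matrix is $\mathrm{Cox}_I=-C_I\,C_I^{-tr}$ and the Coxeter polynomial is $\mathrm{cox}_I(t)=\det(tE-\mathrm{Cox}_I)$. The Coxeter number $\mathbf c_I$ is the least $c\ge 1$ with $\mathrm{Cox}_I^{c}=E$ ($\infty$ if there is none); the reduced Coxeter number $\check{\mathbf c}_I$ is the least $c\ge1$ with $e_i(\mathrm{Cox}_I^{c}-E)\in\operatorname{Ker}q_I$ for all standard basis row vectors $e_i$. The poset $I$ is non-negative of corank $r$ if $G_I$ is positive semi-definite of rank $n-r$, and principal if moreover $r=1$. *Dynkin type.* Let $I$ be connected and non-negative of corank $r$. A special basis of $\operatorname{Ker}q_I$ at $K=\{k_1,\dots,k_r\}\subseteq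 I$ is a $\mathbb Z$-basis $h^{(k_1)},\dots,h^{(k_r)}$ with $h^{(k_i)}_{k_j}=1$ if $i=j$ and $0$ otherwise ($K=\emptyset$ if $r=0$). Then $\mathrm{Dyn}_I$ is the unique simply-laced Dynkin diagram $D\in\{\mathbb A_m\,(m\ge1),\mathbb D_m\,(m\ge4),\mathbb E_6,\mathbb E_7,\mathbb E_8\}$ such that, for $K$ admitting a special basis, $B^{tr}G_{I\setminus K}B=G_D$ for some $\mathbb Z$-invertible matrix $B$, where $G_D$ has diagonal entries $1$, entries $-\frac12$ at edges of $D$, and $0$ elsewhere. (It is part of the claim below that such a $K$ exists and that $D$ exists, is unique, and does not depend on $K$.) *Cycle index.* Let $I$ be connected and principal with $\mathrm{Dyn}_I=\mathbb A_{n-1}$. Enumerate the elements of $I$ cyclically as $a_1,\dots,a_n,a_{n+1}=a_1$ so that, for some $s$ and some $1=r_0<r_1<\dots<r_{2s-1}<r_{2s}=n+1$, the elements $a_{r_0},\dots,a_{r_{2s-1}}$ are exactly the elements that are minimal or maximal, and on each segment $S_j=\{a_{r_j},a_{r_j+1},\dots,a_{r_{j+1}}\}$, $0\le j<2s$, the enumeration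 is increasing or decreasing with respect to $\preceq$. The cycle index is $$c(I)=\max\Big(\sum_{j=0}^{s-1}|S_{2j}|,\ \sum_{j=0}^{s-1}|S_{2j+1}|\Big)-s .$$ (It is part of the claim below that such an enumeration exists and that all of them give the same value.) *Canonical two-peak posets.* Let $n\ge4$ and $\frac n2\le p\le n-2$ be integers. The poset ${}_p\widetilde{\mathbb A}_n$ is the poset on $\{1,\dots,n\}$ whose Hasse quiver (an arrow $i\to j$ means that $j$ covers $i$) consists of the oriented paths $$1\to3\to4\to\cdots\to p\to n,\qquad 2\to p+1\to p+2\to\cdots\to n-2\to n,\qquad 1\to n-1,\qquad 2\to n-1,$$ where the first path is $1\to n$ if $p=2$, and the second path is $2\to n$ if $p=n-2$. **Lemma.** Let $n\ge 4$ and $\frac n2\le p\le n-2$ be integers, and let $I={}_p\widetilde{\mathbb A}_n$. Then: (a) $I$ is (connected and) principal, $\mathrm{Dyn}_I=\mathbb A_{n-1}$, and $\operatorname{Ker}q_I=\mathbb Z\cdot[-1,-1,0,\dots,0,1,1]\subseteq\mathbb Z^n$; (b) $\mathrm{cox}_I(t)=t^n-t^p-t^{n-p}+1=(t-1)^2\,\nu_p\,\nu_{n-p}$,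 where $\nu_m=1+t+\cdots+t^{m-1}$; (c) $\mathbf c_I=\infty$ and $\check{\mathbf c}_I=\operatorname{lcm}(p,n-p)$; (d) $c(I)=p$. -/

import Mathlib

open Polynomial

namespace CoxeterPoset

/-! ### Matrices, forms and numerical invariants of a finite poset -/

section Invariants

variable (α : Type*) [Fintype α] [DecidableEq α] [PartialOrder α]

open scoped Classical in
/-- The incidence matrix `C_I`: the entry at `(i, j)` is `1` if `i ≼ j`, and `0` otherwise. -/
noncomputable def incMatrix : Matrix α α ℤ :=
  Matrix.of fun i j => if i ≤ j then 1 else 0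

/-- The symmetric Gram matrix `G_I = (C_I + C_I^tr) / 2`, with rational entries. -/
noncomputable def gramMatrix : Matrix α α ℚ :=
  (1 / 2 : ℚ) • (incMatrix α + (incMatrix α).transpose).map (Int.cast : ℤ → ℚ)

/-- The incidence bilinear form `b_I(x, y) = x C_I y^tr`. -/
noncomputable def bilinForm (x y : α → ℤ) : ℤ :=
  x ⬝ᵥ (incMatrix α).mulVec y

/-- The incidence quadratic form `q_I(x) = b_I(x, x)`. -/
noncomputable def quadForm (x : α → ℤ) : ℤ := bilinForm α x x

/-- The kernel `Ker q_I = {v ∈ ℤ^I : q_I(v) = 0}`. -/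
def kerQ : Set (α → ℤ) := {v | quadForm α v = 0}

/-- The Coxeter matrix `Cox_I = - C_I C_I^{-tr}`. -/
noncomputable def coxMatrix : Matrix α α ℤ :=
  -(incMatrix α * ((incMatrix α).transpose)⁻¹)

/-- The Coxeter polynomial `det (t E - Cox_I)`. -/
noncomputable def coxPoly : ℤ[X] := (coxMatrix α).charpoly

/-- The Coxeter number: the least `c ≥ 1` with `Cox_I ^ c = E`, and `∞` if there is none. -/
noncomputable def coxNumber : ℕ∞ :=
  sInf ((fun c : ℕ => (c : ℕ∞)) '' {c : ℕ | 1 ≤ c ∧ coxMatrix α ^ c = 1})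

/-- The reduced Coxeter number: the least `c ≥ 1` such that `e_i (Cox_I ^ c - E) ∈ Ker q_I` for
every standard (row) basis vector `e_i`, and `∞` if there is none. -/
noncomputable def redCoxNumber : ℕ∞ :=
  sInf ((fun c : ℕ => (c : ℕ∞)) ''
    {c : ℕ | 1 ≤ c ∧
      ∀ i : α, Matrix.vecMul (Pi.single i 1) (coxMatrix α ^ c - 1) ∈ kerQ α})

/-- `I` is non-negative of corank `r`: the symmetric Gram matrix is positive semi-definite of
rank `|I| - r`. -/
def IsNonnegOfCorank (r : ℕ) : Prop :=
  (gramMatrix α).PosSemidef ∧ (gramMatrix α).rank + r = Fintype.card α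

/-- `I` is principal: it is non-negative of corank one. -/
def IsPrincipal : Prop := IsNonnegOfCorank α 1

end Invariants

/-- The graph `Δ_I` whose edges join the distinct comparable elements of the poset. -/
def compGraph (α : Type*) [PartialOrder α] : SimpleGraph α :=
  SimpleGraph.fromRel fun i j : α => i ≤ j

/-! ### Dynkin types -/

/-- The simply-laced Dynkin diagrams. -/
inductive Dynkin : Type
  | A (m : ℕ) (hm : 1 ≤ m) : Dynkin
  | D (m : ℕ) (hm : 4 ≤ m) : Dynkin
  | E6 : Dynkin
  | E7 : Dynkin
  | E8 : Dynkin

/-- The number of vertices of a Dynkin diagram. -/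
def Dynkin.card : Dynkin → ℕ
  | .A m _ => m
  | .D m _ => m
  | .E6 => 6
  | .E7 => 7
  | .E8 => 8

/-- The edges of the path `0 - 1 - ⋯ - (m - 2)` together with one more edge, which joins the
vertex `m - 1` to the vertex `b` of the path. -/
def forkEdge (m b i j : ℕ) : Prop :=
  (i + 1 = j ∧ j + 1 < m) ∨ (i = b ∧ j + 1 = m)

/-- The edges of a Dynkin diagram on the vertices `0, …, card - 1`, each in one direction. -/
def Dynkin.edge : Dynkin → ℕ → ℕ → Prop
  | .A _ _, i, j => i + 1 = j
  | .D m _, i, j => forkEdge m 1 i j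
  | .E6, i, j => forkEdge 6 2 i j
  | .E7, i, j => forkEdge 7 2 i j
  | .E8, i, j => forkEdge 8 2 i j

/-- A Dynkin diagram as a simple graph. -/
def Dynkin.graph (D : Dynkin) : SimpleGraph (Fin D.card) :=
  SimpleGraph.fromRel fun i j => D.edge i.val j.val

open scoped Classical in
/-- The symmetric Gram matrix of a Dynkin diagram, viewed as a bigraph all of whose edges are
negative: `1` on the diagonal, `-1/2` for each edge, and `0` elsewhere. -/
noncomputable def Dynkin.gram (D : Dynkin) : Matrix (Fin D.card) (Fin D.card) ℚ :=
  1 - (1 / 2 : ℚ) • D.graph.adjMatrix ℚ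

/-- `ℤ`-congruence of two rational square matrices, whose index sets may be different:
`B^tr X B = Y` for some integral matrix `B` that has an integral two-sided inverse. -/
def ZCongruent {ι κ : Type*} [Fintype ι] [DecidableEq ι] [Fintype κ] [DecidableEq κ]
    (X : Matrix ι ι ℚ) (Y : Matrix κ κ ℚ) : Prop :=
  ∃ (B : Matrix ι κ ℤ) (B' : Matrix κ ι ℤ), B * B' = 1 ∧ B' * B = 1 ∧
    (B.map (Int.cast : ℤ → ℚ)).transpose * X * B.map (Int.cast : ℤ → ℚ) = Y

section DynkinType

variable (α : Type*) [Fintype α] [DecidableEq α] [PartialOrder α]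

/-- `Ker q_I` admits a special `ℤ`-basis for the set `K` of elements of `I`: a `ℤ`-basis
`(h^(k))_{k ∈ K}` with `h^(k)_k = 1`, and `h^(k)_{k'} = 0` for `k' ∈ K`, `k' ≠ k`. -/
def HasSpecialBasis (K : Finset α) : Prop :=
  ∃ h : {k // k ∈ K} → α → ℤ, LinearIndependent ℤ h ∧
    (Submodule.span ℤ (Set.range h) : Set (α → ℤ)) = kerQ α ∧
    ∀ k k' : {k // k ∈ K}, h k k'.val = if k = k' then 1 else 0

/-- `I` is connected and non-negative, special `ℤ`-bases of `Ker q_I` exist, and whenever there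
is one for the set `K`, the subposet `I ∖ K` is weakly Gram `ℤ`-congruent with `D`
(for positive `I` the only possible choice is `K = ∅`). -/
def WeaklyReducesTo (D : Dynkin) : Prop :=
  (compGraph α).Connected ∧ (∃ r, IsNonnegOfCorank α r) ∧
    (∃ K : Finset α, HasSpecialBasis α K) ∧
    ∀ K : Finset α, HasSpecialBasis α K → ZCongruent (gramMatrix {i : α // i ∉ K}) D.gram

/-- `Dyn_I = D`: `D` is the unique simply-laced Dynkin diagram to which the connected
non-negative poset `I` reduces. -/
def IsDynkinType (D : Dynkin) : Prop :=
  WeaklyReducesTo α D ∧ ∀ D' : Dynkin, WeaklyReducesTo α D' → D' = D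

end DynkinType

/-! ### The cycle index -/

section CycleIndex

variable (α : Type*) [Fintype α] [DecidableEq α] [PartialOrder α]

/-- A cyclic enumeration `a 1, …, a N` of the poset, `N = |I|`, continued by `a (N + 1) = a 1`.
The elements that are minimal or maximal are `a (r 0), …, a (r (2 s - 1))`, where
`1 = r 0 < r 1 < ⋯ < r (2 s - 1) < r (2 s) = N + 1`, and on each of the segments
`a (r j), …, a (r (j + 1))` the enumeration is either increasing or decreasing. -/
structure IsCyclicEnum (s : ℕ) (a : ℕ → α) (r : ℕ → ℕ) : Prop where
  bijOn : Set.BijOn a (Set.Icc 1 (Fintype.card α)) Set.univ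
  wrap : a (Fintype.card α + 1) = a 1
  first : r 0 = 1
  last : r (2 * s) = Fintype.card α + 1
  lt_succ : ∀ j < 2 * s, r j < r (j + 1)
  extremal : ∀ i ∈ Set.Icc 1 (Fintype.card α),
    (IsMin (a i) ∨ IsMax (a i)) ↔ ∃ j < 2 * s, r j = i
  monotone : ∀ j < 2 * s,
    (∀ u v, r j ≤ u → u < v → v ≤ r (j + 1) → a u ≤ a v) ∨
    (∀ u v, r j ≤ u → u < v → v ≤ r (j + 1) → a v ≤ a u)

variable {α}

/-- The segment `{a (r j), …, a (r (j + 1))}`. -/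
def segment (a : ℕ → α) (r : ℕ → ℕ) (j : ℕ) : Finset α :=
  (Finset.Icc (r j) (r (j + 1))).image a

/-- The larger of the total sizes of the even and of the odd segments, minus `s`. -/
def enumValue (s : ℕ) (a : ℕ → α) (r : ℕ → ℕ) : ℕ :=
  max (∑ j ∈ Finset.range s, (segment a r (2 * j)).card)
    (∑ j ∈ Finset.range s, (segment a r (2 * j + 1)).card) - s

variable (α)

/-- `c(I) = c`: cyclic enumerations exist, and each of them yields the value `c`. -/
def IsCycleIndex (c : ℕ) : Prop :=
  (∃ s a r, IsCyclicEnum α s a r) ∧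
    ∀ s a r, IsCyclicEnum α s a r → enumValue s a r = c

end CycleIndex

/-! ### The canonical two-peak poset -/

/-- The underlying set `{1, …, n}` of the canonical two-peak poset with parameter `p`. -/
def TwoPeak (n _p : ℕ) : Type := {i : ℕ // i ∈ Finset.Icc 1 n}

namespace TwoPeak

instance (n p : ℕ) : Fintype (TwoPeak n p) :=
  inferInstanceAs (Fintype {i : ℕ // i ∈ Finset.Icc 1 n})

instance (n p : ℕ) : DecidableEq (TwoPeak n p) :=
  inferInstanceAs (DecidableEq {i : ℕ // i ∈ Finset.Icc 1 n})

/-- The arrows `i → j` of the Hasse quiver, which consists of the four oriented paths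
`1 → 3 → 4 → ⋯ → p → n`, `2 → p + 1 → p + 2 → ⋯ → n - 2 → n`, `1 → n - 1` and `2 → n - 1`;
for `p = 2` the first path is `1 → n`, and for `p = n - 2` the second one is `2 → n`.
(The requirement `i < j` is redundant when `n ≥ 4`.) -/
def Arrow (n p i j : ℕ) : Prop :=
  i < j ∧
    ((i = 1 ∧ j = if 3 ≤ p then 3 else n) ∨
     (3 ≤ i ∧ i < p ∧ j = i + 1) ∨
     (3 ≤ i ∧ i = p ∧ j = n) ∨
     (i = 2 ∧ j = if p + 1 ≤ n - 2 then p + 1 else n) ∨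
     (p + 1 ≤ i ∧ i < n - 2 ∧ j = i + 1) ∨
     (p + 1 ≤ i ∧ i = n - 2 ∧ j = n) ∨
     ((i = 1 ∨ i = 2) ∧ j = n - 1))

/-- `i ≼ j` if and only if there is an oriented path from `i` to `j` in the Hasse quiver. -/
def Le (n p : ℕ) : TwoPeak n p → TwoPeak n p → Prop :=
  Relation.ReflTransGen fun x y => Arrow n p x.val y.val

theorem Le.val_le {n p : ℕ} {x y : TwoPeak n p} (h : Le n p x y) : x.val ≤ y.val := by
  induction h with
  | refl => exact le_rfl
  | tail _ hyz ih => exact ih.trans hyz.1.le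

instance (n p : ℕ) : PartialOrder (TwoPeak n p) where
  le := Le n p
  le_refl _ := Relation.ReflTransGen.refl
  le_trans _ _ _ h₁ h₂ := Relation.ReflTransGen.trans h₁ h₂
  le_antisymm _ _ h₁ h₂ := Subtype.ext (le_antisymm h₁.val_le h₂.val_le)

/-- The order in explicit form. -/
theorem Le.explicit {n p : ℕ} (hp : n ≤ 2 * p) (hpn : p + 2 ≤ n) {x y : TwoPeak n p}
    (h : x ≤ y) : x = y ∨
      (x.val < y.val ∧
        (((x.val = 1 ∨ 3 ≤ x.val ∧ x.val ≤ p) ∧ (3 ≤ y.val ∧ y.val ≤ p ∨ y.val = n)) ∨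
         ((x.val = 2 ∨ p + 1 ≤ x.val ∧ x.val ≤ n - 2) ∧
            (p + 1 ≤ y.val ∧ y.val ≤ n - 2 ∨ y.val = n)) ∨
         ((x.val = 1 ∨ x.val = 2) ∧ y.val = n - 1))) := by
  induction (h : Le n p x y) with
  | refl => exact Or.inl rfl
  | @tail y z _ hyz ih =>
    right
    have hx := Finset.mem_Icc.1 x.2
    obtain ⟨hlt, hyz⟩ := hyz
    rcases ih with rfl | ih
    · refine ⟨hlt, ?_⟩
      split_ifs at hyz <;> omega
    · refine ⟨ih.1.trans hlt, ?_⟩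
      split_ifs at hyz <;> omega

/-- The covering relation of the order is given by the prescribed arrows. -/
theorem covBy_iff {n p : ℕ} (hp : n ≤ 2 * p) (hpn : p + 2 ≤ n) (x y : TwoPeak n p) :
    x ⋖ y ↔ Arrow n p x.val y.val := by
  constructor
  · intro h
    rcases Relation.ReflTransGen.cases_head (h.le : Le n p x y) with rfl | ⟨z, hxz, hzy⟩
    · exact absurd h.lt (lt_irrefl _)
    · have hxz' : x < z := lt_of_le_of_ne (Relation.ReflTransGen.single hxz : Le n p x z)
        (fun e => absurd hxz.1 (by rw [e]; exact lt_irrefl _))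
      have : z = y := ((show z ≤ y from hzy).lt_or_eq).resolve_left (h.2 hxz')
      exact this ▸ hxz
  · intro h
    refine ⟨lt_of_le_of_ne (Relation.ReflTransGen.single h : Le n p x y)
      (fun e => absurd h.1 (by rw [e]; exact lt_irrefl _)), fun z hxz hzy => ?_⟩
    have hx := Finset.mem_Icc.1 x.2
    obtain ⟨_, h⟩ := h
    have h₁ := (Le.explicit hp hpn hxz.le).resolve_left hxz.ne
    have h₂ := (Le.explicit hp hpn hzy.le).resolve_left hzy.ne
    split_ifs at h <;> omega

/-- The vector `[-1, -1, 0, …, 0, 1, 1]`. -/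
def kerVec (n p : ℕ) : TwoPeak n p → ℤ := fun i =>
  if i.val = 1 ∨ i.val = 2 then -1 else if i.val = n - 1 ∨ i.val = n then 1 else 0

end TwoPeak

/-- The polynomial `ν_m = 1 + t + ⋯ + t^(m - 1)`. -/
noncomputable def nu (m : ℕ) : ℤ[X] := ∑ i ∈ Finset.range m, X ^ i

end CoxeterPoset

namespace CoxeterPoset

/-! Let `h` be `kerVec` and `C` the incidence matrix. All four parts rest on the shape of the Hasse
quiver. Once `n - 1` is deleted it becomes the path `1, 3, …, p, n, n - 2, …, p + 1, 2` with every
arrow pointing towards `n`, and `n - 1` closes the path to a cycle.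

Gram matrix and Dynkin type. One has `h C = -(1, …, 1)` and `h C^tr = (1, …, 1)`, so `h` is in the
radical (`gramMatrix_mulVec_kerVec`). On the complement of `n - 1`, the vectors `e_a - e_b` for the
arrows `a → b`, together with `e_n`, form a basis in which the Gram matrix is that of `𝔸_{n-1}`
(`zCongruent_compl`). Since the latter is positive definite and `h` is a unit at `n - 1`, the form
is non-negative of corank one with kernel `ℤ h` (`nonneg_of_radical`). A special basis exists
exactly for the singletons in the support of `h`, and the corresponding complements are congruent to
one another by clearing along `h` (`zCongruent_submatrix_of_radical`). Uniqueness comes from the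
discriminant group: for `𝔸_m` it is cyclic of order `m + 1`, whereas those of `𝔻_m`, `𝔼_6`, `𝔼_7`,
`𝔼_8` are killed by `4`, `3`, `2`, `1` (`eq_A_of_zCongruent`).

Coxeter matrix. It permutes cyclically the `p` vectors `tubeL` and the `n - p` vectors `tubeR`, each
family having sum `-h`, and it sends `e_n` to `e_n + tubeL 0 + tubeR 0`. These vectors generate the
lattice, with the equality of the two sums as the only relation. Dropping one vector of the second
cycle gives a basis in which the Coxeter matrix is block triangular with characteristic polynomial
`(t^p - 1) ν_{n-p} (t - 1)` (`coxPoly_eq`). If `c = p a = (n - p) b`, the `c`-th power fixes both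
cycles and moves `e_n` by `-(a + b) h`. Hence the order is infinite, but modulo `ℤ h` it is the
least common multiple of the cycle lengths.

Cycle index. Every cyclic enumeration has four segments, joining the extremal elements in the cyclic
order `1, n, 2, n - 1`. Their lengths are bounded by `p - 1`, `n - p - 1`, `1`, `1`. These bounds
add up to `n`, so all are attained, and the two opposite pairs have total lengths `p` and `n - p`.
-/

/-! ### Companion matrices -/

/-- A matrix whose rows are the shifted unit vectors, except for the last one, is a companion
matrix, and its characteristic polynomial is read off from the last row. -/
theorem charpoly_of_shift_rows {m : ℕ} (hm : 0 < m) (M : Matrix (Fin m) (Fin m) ℤ) (c : ℕ → ℤ)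
    (hs : ∀ (i : Fin m) (h : i.val + 1 < m), M i = Pi.single ⟨i.val + 1, h⟩ 1)
    (hl : ∀ j : Fin m, M ⟨m - 1, by omega⟩ j = - c j) :
    M.charpoly = X ^ m + ∑ i ∈ Finset.range m, C (c i) * X ^ i := by
  have hdeg : M.charpoly.natDegree = m := by simp [Matrix.charpoly_natDegree_eq_dim]
  have hrow : ∀ i (h : i < m), (M ^ i) ⟨0, hm⟩ = Pi.single ⟨i, h⟩ 1 := by
    intro i
    induction i with
    | zero => intro h; ext j; simp [Matrix.one_apply, Pi.single_apply, eq_comm]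
    | succ i ih =>
      intro h
      rw [pow_succ, Matrix.mul_apply_eq_vecMul, ih (by omega), Matrix.single_one_vecMul]
      exact hs ⟨i, by omega⟩ h
  have hlast : ∀ j : Fin m, (M ^ m) ⟨0, hm⟩ j = - c j := by
    intro j
    obtain ⟨k, rfl⟩ : ∃ k, m = k + 1 := ⟨m - 1, by omega⟩
    rw [pow_succ, Matrix.mul_apply_eq_vecMul, hrow k (by omega), Matrix.single_one_vecMul]
    exact hl j
  have hsum := M.charpoly_monic.as_sum
  rw [hdeg] at hsum
  -- In row `0` of the Cayley–Hamilton identity the power `M ^ i` contributes the `i`-th unit vector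
  -- for `i < m`, so each coefficient is isolated in its own column.
  have hCH := M.aeval_self_charpoly
  rw [hsum] at hCH
  have hcoef : ∀ j : Fin m, M.charpoly.coeff j = c j := by
    intro j
    have h := congrFun (congrFun hCH ⟨0, hm⟩) j
    simp only [map_add, map_sum, map_mul, map_pow, aeval_X, aeval_C, Matrix.add_apply,
      Matrix.sum_apply, Matrix.zero_apply, hlast, Algebra.algebraMap_eq_smul_one, smul_mul_assoc,
      one_mul, Matrix.smul_apply, smul_eq_mul] at h
    rw [Finset.sum_eq_single j.val] at h
    · rw [hrow j j.2] at h
      simp at h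
      linarith
    · intro b hb hbj
      rw [hrow b (Finset.mem_range.1 hb), Pi.single_apply, if_neg, mul_zero]
      exact fun e => hbj (by rw [e])
    · intro h; exact absurd (Finset.mem_range.2 j.2) h
  rw [hsum]
  congr 1
  exact Finset.sum_congr rfl fun i hi => by rw [hcoef ⟨i, Finset.mem_range.1 hi⟩]

/-! ### `ℤ`-congruence and complements along a radical vector -/

section Congruence

variable {ι κ μ : Type*} [Fintype ι] [DecidableEq ι] [Fintype κ] [DecidableEq κ]
  [Fintype μ] [DecidableEq μ]

omit [Fintype ι] [DecidableEq ι] [DecidableEq κ] [Fintype μ] [DecidableEq μ] in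
theorem intCast_map_mul (A : Matrix ι κ ℤ) (B : Matrix κ μ ℤ) :
    (A * B).map (Int.cast : ℤ → ℚ) = A.map (Int.cast : ℤ → ℚ) * B.map (Int.cast : ℤ → ℚ) :=
  Matrix.map_mul (f := Int.castRingHom ℚ)

omit [Fintype ι] in
theorem intCast_map_one : (1 : Matrix ι ι ℤ).map (Int.cast : ℤ → ℚ) = 1 :=
  Matrix.map_one _ Int.cast_zero Int.cast_one

theorem ZCongruent.symm {X : Matrix ι ι ℚ} {Y : Matrix κ κ ℚ} (h : ZCongruent X Y) :
    ZCongruent Y X := by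
  obtain ⟨B, B', h₁, h₂, h₃⟩ := h
  refine ⟨B', B, h₂, h₁, ?_⟩
  have h₄ : B.map (Int.cast : ℤ → ℚ) * B'.map (Int.cast : ℤ → ℚ) = 1 := by
    rw [← intCast_map_mul, h₁, intCast_map_one]
  rw [← h₃]
  calc _ = (B.map (Int.cast : ℤ → ℚ) * B'.map (Int.cast : ℤ → ℚ)).transpose * X *
        (B.map (Int.cast : ℤ → ℚ) * B'.map (Int.cast : ℤ → ℚ)) := by
          simp only [Matrix.transpose_mul, Matrix.mul_assoc]
    _ = X := by rw [h₄]; simp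

theorem ZCongruent.trans {X : Matrix ι ι ℚ} {Y : Matrix κ κ ℚ} {Z : Matrix μ μ ℚ}
    (h : ZCongruent X Y) (h' : ZCongruent Y Z) : ZCongruent X Z := by
  obtain ⟨B, B', h₁, h₂, h₃⟩ := h
  obtain ⟨D, D', k₁, k₂, k₃⟩ := h'
  refine ⟨B * D, D' * B', ?_, ?_, ?_⟩
  · rw [Matrix.mul_assoc, ← Matrix.mul_assoc D, k₁, Matrix.one_mul, h₁]
  · rw [Matrix.mul_assoc, ← Matrix.mul_assoc B', h₂, Matrix.one_mul, k₂]
  · rw [← k₃, ← h₃]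
    simp only [intCast_map_mul, Matrix.transpose_mul, Matrix.mul_assoc]

theorem ZCongruent.card_eq {X : Matrix ι ι ℚ} {Y : Matrix κ κ ℚ} (h : ZCongruent X Y) :
    Fintype.card ι = Fintype.card κ := by
  obtain ⟨B, B', h₁, h₂, -⟩ := h
  have h₁' : B.map (Int.cast : ℤ → ℚ) * B'.map (Int.cast : ℤ → ℚ) = 1 := by
    rw [← intCast_map_mul, h₁, intCast_map_one]
  have h₂' : B'.map (Int.cast : ℤ → ℚ) * B.map (Int.cast : ℤ → ℚ) = 1 := by
    rw [← intCast_map_mul, h₂, intCast_map_one]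
  exact Matrix.square_of_invertible _ _ h₁' h₂'

-- The summand at `k` vanishes in every entry, so deleting `k` from the inner index changes nothing.
-- This turns identities between full matrices into identities for the complement of `k`.
omit [Fintype κ] [DecidableEq κ] [Fintype μ] [DecidableEq μ] in
theorem submatrix_mul_submatrix_compl {R : Type*} [CommRing R] {K : Finset ι} {k : ι}
    (hK : K = {k}) (A : Matrix κ ι R) (M : Matrix ι μ R) (h : ∀ i j, A i k * M k j = 0)
    {κ' μ' : Type*} (f : κ' → κ) (g : μ' → μ) :
    A.submatrix f (fun i : {i : ι // i ∉ K} => i.val) *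
      M.submatrix (fun i : {i : ι // i ∉ K} => i.val) g = (A * M).submatrix f g := by
  subst hK
  ext i j
  rw [Matrix.submatrix_apply, Matrix.mul_apply, Matrix.mul_apply,
    ← Finset.sum_erase Finset.univ (a := k) (f := fun l => A (f i) l * M l (g j)) (h _ _),
    Finset.sum_subtype (p := fun i => i ∉ ({k} : Finset ι)) _ (by simp)]
  rfl

/-- The unipotent matrix that subtracts the multiple of `d` which clears the entry at `k`. -/
def clearMatrix (d : ι → ℤ) (k : ι) : Matrix ι ι ℤ :=
  1 - Matrix.vecMulVec d (Pi.single k (d k))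

omit [Fintype ι] in
theorem clearMatrix_row (d : ι → ℤ) {k : ι} (hk : d k * d k = 1) (j : ι) :
    clearMatrix d k k j = 0 := by
  rcases eq_or_ne j k with rfl | h
  · simp [clearMatrix, Matrix.vecMulVec_apply, hk]
  · simp [clearMatrix, Matrix.vecMulVec_apply, h, Matrix.one_apply_ne h.symm]

/-- Since `d k` is a unit of square one, `clearMatrix d k` kills `d`, so it absorbs `clearMatrix d
z` on its right; and it differs from the identity only in column `k`. This is why the blocks
clearing at `k` and at `z` are mutually inverse. -/
theorem clearMatrix_mul_apply (d : ι → ℤ) {k z : ι} (hk : d k * d k = 1) (i : ι) {j : ι}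
    (hj : j ≠ k) : (clearMatrix d k * clearMatrix d z) i j = if i = j then 1 else 0 := by
  have : clearMatrix d k * clearMatrix d z = clearMatrix d k := by
    rw [clearMatrix, clearMatrix, Matrix.mul_sub, Matrix.mul_one, Matrix.sub_mul,
      Matrix.vecMulVec_mul_vecMulVec, single_dotProduct, hk, one_smul, Matrix.one_mul, sub_self,
      sub_zero]
  rw [this]
  simp [clearMatrix, Matrix.vecMulVec_apply, hj, Matrix.one_apply]

theorem mul_clearMatrix (X : Matrix ι ι ℚ) (d : ι → ℤ)
    (hd : X.mulVec (fun i => (d i : ℚ)) = 0) (k : ι) :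
    X * (clearMatrix d k).map (Int.cast : ℤ → ℚ) = X := by
  have : (clearMatrix d k).map (Int.cast : ℤ → ℚ) = 1 - Matrix.vecMulVec (fun i => (d i : ℚ))
      (fun i => ((Pi.single k (d k) : ι → ℤ) i : ℚ)) := by
    ext i j
    simp [clearMatrix, Matrix.vecMulVec_apply, Matrix.one_apply]
  rw [this, Matrix.mul_sub, Matrix.mul_vecMulVec, hd, Matrix.mul_one, Matrix.zero_vecMulVec,
    sub_zero]

theorem transpose_clearMatrix_mul (X : Matrix ι ι ℚ) (hX : X.transpose = X) (d : ι → ℤ)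
    (hd : X.mulVec (fun i => (d i : ℚ)) = 0) (k : ι) :
    ((clearMatrix d k).map (Int.cast : ℤ → ℚ)).transpose * X = X := by
  rw [← Matrix.transpose_inj, Matrix.transpose_mul, Matrix.transpose_transpose, hX,
    mul_clearMatrix X d hd]

/-- Two complements of an element at which a radical vector is a unit are congruent. -/
theorem zCongruent_submatrix_of_radical (X : Matrix ι ι ℚ) (hX : X.transpose = X) (d : ι → ℤ)
    (hd : X.mulVec (fun i => (d i : ℚ)) = 0) {k z : ι} (hk : d k * d k = 1) (hz : d z * d z = 1)
    {K L : Finset ι} (hK : K = {k}) (hL : L = {z}) :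
    ZCongruent
      (X.submatrix (fun i : {i : ι // i ∉ K} => i.val) (fun i : {i : ι // i ∉ K} => i.val))
      (X.submatrix (fun i : {i : ι // i ∉ L} => i.val) (fun i : {i : ι // i ∉ L} => i.val)) := by
  have hone : ∀ (k z : ι) (K L : Finset ι), K = {k} → L = {z} → d k * d k = 1 → d z * d z = 1 →
      (clearMatrix d k).submatrix (fun i : {i : ι // i ∉ K} => i.val)
        (fun i : {i : ι // i ∉ L} => i.val) *
        (clearMatrix d z).submatrix (fun i : {i : ι // i ∉ L} => i.val)
        (fun i : {i : ι // i ∉ K} => i.val) = 1 := by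
    intro k z K L hK hL hk hz
    rw [submatrix_mul_submatrix_compl hL _ _ fun i j => by rw [clearMatrix_row d hz, mul_zero]]
    ext i j
    have hj : j.val ≠ k := fun e => j.2 (e.symm ▸ hK.symm ▸ Finset.mem_singleton_self k)
    rw [Matrix.submatrix_apply, clearMatrix_mul_apply d hk _ hj, Matrix.one_apply]
    simp [Subtype.ext_iff]
  -- The congruence is the block of `clearMatrix d k` with row `k` and column `z` removed. Row `k`
  -- is zero and `d` is in the radical, so the triple product is just `X` restricted.
  refine ⟨_, _, hone k z K L hK hL hk hz, hone z k L K hL hK hz hk, ?_⟩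
  set c := (clearMatrix d k).map (Int.cast : ℤ → ℚ) with hc
  have hrow : ∀ j, c k j = 0 := fun j => by simp [hc, clearMatrix_row d hk]
  rw [← Matrix.submatrix_map, Matrix.transpose_submatrix, ← hc,
    submatrix_mul_submatrix_compl hK _ _ fun i j => by
      rw [Matrix.transpose_apply, hrow, zero_mul],
    submatrix_mul_submatrix_compl hK _ _ fun i j => by rw [hrow, mul_zero], hc,
    transpose_clearMatrix_mul X hX d hd, mul_clearMatrix X d hd]

end Congruence

/-! ### Discriminant groups of Dynkin diagrams, and positivity of `𝔸_m` -/

namespace Dynkin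

open scoped Classical in
theorem gram_apply (D : Dynkin) (i j : Fin D.card) : D.gram i j =
    if i = j then 1 else if D.edge i j ∨ D.edge j i then -(1 / 2) else 0 := by
  by_cases h : i = j
  · subst h; simp [Dynkin.gram]
  · have : D.graph.Adj i j ↔ D.edge i j ∨ D.edge j i := by simp [Dynkin.graph, h]
    simp only [Dynkin.gram, Matrix.sub_apply, Matrix.one_apply_ne h, Matrix.smul_apply,
      SimpleGraph.adjMatrix_apply, this, h, if_false]
    split_ifs <;> simp

open scoped Classical in
/-- The Cartan matrix of a Dynkin diagram. -/
noncomputable def cartan (D : Dynkin) : Matrix (Fin D.card) (Fin D.card) ℤ :=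
  Matrix.of fun i j => if i = j then 2 else if D.edge i j ∨ D.edge j i then -1 else 0

theorem cartan_map (D : Dynkin) : D.cartan.map (Int.cast : ℤ → ℚ) = (2 : ℚ) • D.gram := by
  ext i j
  simp only [Matrix.map_apply, cartan, Matrix.of_apply, Matrix.smul_apply, gram_apply, smul_eq_mul]
  split_ifs <;> norm_num

/-- Taking the vector on all of `ℕ` and the neighbours as a set `S` of numbers lets each row of a
Cartan matrix be evaluated by arithmetic on indices. -/
theorem cartan_mulVec (D : Dynkin) (V : ℕ → ℤ) (i : Fin D.card) (S : Finset ℕ)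
    (hi : i.val ∉ S) (hS : ∀ j, j ∈ S ↔ j < D.card ∧ (D.edge i j ∨ D.edge j i)) :
    D.cartan.mulVec (fun j => V j) i = 2 * V i - ∑ j ∈ S, V j := by
  have : ∀ j : Fin D.card, D.cartan i j * V j =
      (if i = j then 2 * V j else 0) - (if j.val ∈ S then V j else 0) := by
    intro j
    have hj : j.val ∈ S ↔ D.edge i j ∨ D.edge j i := by simp [hS]
    simp only [cartan, Matrix.of_apply, ← hj]
    rcases eq_or_ne i j with rfl | h
    · simp [hi]
    · simp only [h, if_false]; split_ifs <;> simp
  simp only [Matrix.mulVec, dotProduct, this, Finset.sum_sub_distrib, Finset.sum_ite_eq,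
    Finset.mem_univ, if_true]
  congr 1
  rw [Fin.sum_univ_eq_sum_range (fun j => if j ∈ S then V j else 0), Finset.sum_ite_mem,
    Finset.inter_eq_right.2 fun j hj => Finset.mem_range.2 ((hS j).1 hj).1]

/-- Second differences of `1, 2, …, m` vanish except at the far end. Divided by `m + 1`, this vector
represents an element of order `m + 1` in the discriminant group. -/
theorem cartan_A_mulVec (m : ℕ) (hm : 2 ≤ m) (h1m : 1 ≤ m) (i : Fin (Dynkin.A m h1m).card) :
    (Dynkin.A m h1m).cartan.mulVec (fun j => (j.val : ℤ) + 1) i =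
      (m + 1) * (if i.val + 1 = m then 1 else 0) := by
  have hi : i.val < m := i.2
  have key := cartan_mulVec (Dynkin.A m h1m) (fun j => (j : ℤ) + 1) i
  change ∀ S : Finset ℕ, _ → (∀ j, j ∈ S ↔ j < m ∧ (i.val + 1 = j ∨ j + 1 = i.val)) → _ at key
  rcases Nat.eq_zero_or_pos i.val with h0 | h0
  · rw [key {1} (by simp; omega) (fun j => by simp; omega), if_neg (by omega)]
    simp [h0]
  rcases Nat.lt_or_ge (i.val + 1) m with h1 | h1
  · rw [key {i.val - 1, i.val + 1} (by simp; omega) (fun j => by simp; omega), if_neg (by omega),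
      Finset.sum_pair (by omega)]
    push_cast [Nat.cast_sub h0]; ring
  · rw [key {i.val - 1} (by simp; omega) (fun j => by simp; omega), if_pos (by omega),
      Finset.sum_singleton]
    have : (m : ℤ) = i.val + 1 := by omega
    push_cast [Nat.cast_sub h0]; rw [this]; ring

/-- If `𝔸_m` is congruent with `D`, then the order `m + 1` of its discriminant group, which is
cyclic, divides each number that annihilates the discriminant group of `D`. -/
theorem dvd_of_zCongruent_A {m : ℕ} (hm : 2 ≤ m) (h1m : 1 ≤ m) (D : Dynkin)
    (h : ZCongruent (Dynkin.A m h1m).gram D.gram) (k : ℤ)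
    (hk : ∀ v : Fin D.card → ℤ, (∀ i, (m + 1 : ℤ) ∣ D.cartan.mulVec v i) →
      ∀ i, (m + 1 : ℤ) ∣ k * v i) : (m + 1 : ℤ) ∣ k := by
  obtain ⟨B, B', h₁, h₂, h₃⟩ := h
  have hB : B.transpose * (Dynkin.A m h1m).cartan * B = D.cartan := by
    have : Function.Injective fun M : Matrix (Fin D.card) (Fin D.card) ℤ =>
        M.map (Int.cast : ℤ → ℚ) := Matrix.map_injective Int.cast_injective
    refine this ?_
    simp only [intCast_map_mul, cartan_map, ← h₃]
    simp only [Matrix.transpose_map, Matrix.mul_smul, Matrix.smul_mul]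
  set u : Fin (Dynkin.A m h1m).card → ℤ := fun j => (j.val : ℤ) + 1 with hu
  have hv : B.mulVec (B'.mulVec u) = u := by rw [Matrix.mulVec_mulVec, h₁, Matrix.one_mulVec]
  have hd : ∀ i, (m + 1 : ℤ) ∣ D.cartan.mulVec (B'.mulVec u) i := by
    intro i
    rw [← hB, ← Matrix.mulVec_mulVec, hv, ← Matrix.mulVec_mulVec, Matrix.mulVec, dotProduct]
    refine Finset.dvd_sum fun j _ => Dvd.dvd.mul_left ?_ _
    exact Dvd.intro _ (cartan_A_mulVec m hm h1m j).symm
  -- Entry `0` of `u` is `1`, so divisibility of all entries of `k • u` by `m + 1` already gives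
  -- divisibility of `k`.
  set z : Fin (Dynkin.A m h1m).card := ⟨0, show 0 < m by omega⟩
  have h0 := congrFun hv z
  have : k = k * B.mulVec (B'.mulVec u) z := by rw [h0]; simp [hu]
  rw [this, Matrix.mulVec, dotProduct, Finset.mul_sum]
  refine Finset.dvd_sum fun j _ => ?_
  have := (hk _ hd j).mul_left (B z j)
  convert this using 1
  ring

/-- Modulo `N`, the path from its end `m - 2` to the branch vertex `1` is an arithmetic progression
`V (m - 2 - j) ≡ (j + 1) V (m - 2)`. The leaves `0` and `m - 1` satisfy `2 V ≡ V 1`, so doubling the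
equation at `1` gives `2 V 1 ≡ 2 V 2`. Hence `2 V (m - 2) ≡ 0`, every path value from `1` to `m - 2`
is killed by `2`, and the two leaves are killed by `4`. -/
theorem dvd_four_mul_of_cartan_D (m : ℕ) (hm : 4 ≤ m) (N : ℤ) (v : Fin (Dynkin.D m hm).card → ℤ)
    (h : ∀ i, N ∣ (Dynkin.D m hm).cartan.mulVec v i) (i : Fin (Dynkin.D m hm).card) :
    N ∣ 4 * v i := by
  obtain ⟨V, rfl⟩ : ∃ V : ℕ → ℤ, v = fun i => V i.val :=
    ⟨fun i => if h : i < (Dynkin.D m hm).card then v ⟨i, h⟩ else 0, funext fun i => by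
      simp [i.2]⟩
  have key : ∀ (i : ℕ), i < m → ∀ (S : Finset ℕ), i ∉ S →
      (∀ j, j ∈ S ↔ j < m ∧ (forkEdge m 1 i j ∨ forkEdge m 1 j i)) →
      N ∣ 2 * V i - ∑ j ∈ S, V j := by
    intro i hi S h1 h2
    have := h ⟨i, hi⟩
    rwa [cartan_mulVec (Dynkin.D m hm) V ⟨i, hi⟩ S h1 h2] at this
  have e0 := key 0 (by omega) {1} (by simp) (fun j => by simp [forkEdge]; omega)
  have el := key (m - 1) (by omega) {1} (by simp; omega) (fun j => by simp [forkEdge]; omega)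
  have e1 := key 1 (by omega) {0, 2, m - 1} (by simp; omega) (fun j => by simp [forkEdge]; omega)
  have ee := key (m - 2) (by omega) {m - 3} (by simp; omega) (fun j => by simp [forkEdge]; omega)
  have em : ∀ i, 2 ≤ i → i + 3 ≤ m → N ∣ 2 * V i - (V (i - 1) + V (i + 1)) := by
    intro i h2 h3
    have := key i (by omega) {i - 1, i + 1} (by simp; omega) (fun j => by simp [forkEdge]; omega)
    rwa [Finset.sum_pair (by omega)] at this
  rw [Finset.sum_insert (by simp; omega), Finset.sum_pair (by omega)] at e1
  rw [Finset.sum_singleton] at e0 el ee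
  have hpath : ∀ j : ℕ, j + 4 ≤ m → (∃ x, V (m - 2 - j) - (j + 1) * V (m - 2) = N * x) ∧
      ∃ x, V (m - 2 - (j + 1)) - (j + 2) * V (m - 2) = N * x := by
    intro j
    induction j with
    | zero =>
      intro h
      obtain ⟨y, hy⟩ := ee
      exact ⟨⟨0, by simp⟩, -y, by
        rw [show m - 2 - (0 + 1) = m - 3 by omega]; push_cast; linear_combination -hy⟩
    | succ j ih =>
      intro h
      obtain ⟨⟨x, hx⟩, y, hy⟩ := ih (by omega)
      obtain ⟨c, hc⟩ := em (m - 2 - (j + 1)) (by omega) (by omega)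
      rw [show m - 2 - (j + 1) - 1 = m - 2 - (j + 1 + 1) by omega,
        show m - 2 - (j + 1) + 1 = m - 2 - j by omega] at hc
      exact ⟨⟨y, by push_cast; linear_combination hy⟩, 2 * y - x - c, by
        push_cast; linear_combination 2 * hy - hx - hc⟩
  obtain ⟨a, ha⟩ := e0
  obtain ⟨b, hb⟩ := el
  obtain ⟨c, hc⟩ := e1
  obtain ⟨⟨x, hx⟩, y, hy⟩ := hpath (m - 4) (by omega)
  rw [show m - 2 - (m - 4) = 2 by omega] at hx
  rw [show m - 2 - (m - 4 + 1) = 1 by omega] at hy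
  obtain ⟨w, hw⟩ : ∃ w, 2 * V (m - 2) = N * w :=
    ⟨a + b + 2 * c - 2 * y + 2 * x, by linear_combination ha + hb + 2 * hc - 2 * hy + 2 * hx⟩
  obtain ⟨t, h1⟩ : ∃ t, 2 * V 1 = N * t :=
    ⟨2 * y + ((m - 4 : ℕ) + 2) * w, by linear_combination 2 * hy + ((m - 4 : ℕ) + 2) * hw⟩
  have hmid : ∀ j, 1 ≤ j → j + 2 ≤ m → ∃ x, 2 * V j = N * x := by
    intro j hj hj'
    rcases Nat.eq_or_lt_of_le hj with rfl | hj
    · exact ⟨_, h1⟩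
    · obtain ⟨⟨x, hx⟩, -⟩ := hpath (m - 2 - j) (by omega)
      rw [show m - 2 - (m - 2 - j) = j by omega] at hx
      exact ⟨2 * x + ((m - 2 - j : ℕ) + 1) * w, by
        linear_combination 2 * hx + ((m - 2 - j : ℕ) + 1) * hw⟩
  have hi : i.val < m := i.2
  change N ∣ 4 * V i.val
  rcases Nat.eq_zero_or_pos i.val with h0 | h0
  · rw [h0]
    exact ⟨2 * a + t, by linear_combination 2 * ha + h1⟩
  rcases Nat.lt_or_ge (i.val + 1) m with h2 | h2
  · obtain ⟨y, hy⟩ := hmid i h0 (by omega)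
    exact ⟨2 * y, by linear_combination 2 * hy⟩
  · rw [show i.val = m - 1 by omega]
    exact ⟨2 * b + t, by linear_combination 2 * hb + h1⟩

/-- An integral inverse up to the factor `k` annihilates the discriminant group. -/
theorem dvd_mul_of_mul_cartan (D : Dynkin) (k : ℤ) (M : Matrix (Fin D.card) (Fin D.card) ℤ)
    (hM : M * D.cartan = k • 1) (N : ℤ) (v : Fin D.card → ℤ)
    (h : ∀ i, N ∣ D.cartan.mulVec v i) (i : Fin D.card) : N ∣ k * v i := by
  have : k * v i = ∑ j, M i j * D.cartan.mulVec v j := by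
    change _ = M.mulVec (D.cartan.mulVec v) i
    rw [Matrix.mulVec_mulVec, hM, Matrix.smul_mulVec, Matrix.one_mulVec, Pi.smul_apply, smul_eq_mul]
  rw [this]
  exact Finset.dvd_sum fun j _ => (h j).mul_left _

instance (m b i j : ℕ) : Decidable (forkEdge m b i j) :=
  inferInstanceAs (Decidable ((i + 1 = j ∧ j + 1 < m) ∨ (i = b ∧ j + 1 = m)))

/-- The explicit matrix is the determinant `3` times the inverse Cartan matrix. The next two are its
analogues, with determinants `2` and `1`. -/
theorem mul_cartan_E6 :
    (show Matrix (Fin Dynkin.E6.card) (Fin Dynkin.E6.card) ℤ from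
      !![4, 5, 6, 4, 2, 3; 5, 10, 12, 8, 4, 6; 6, 12, 18, 12, 6, 9; 4, 8, 12, 10, 5, 6;
      2, 4, 6, 5, 4, 3; 3, 6, 9, 6, 3, 6]) * Dynkin.E6.cartan =
      (3 : ℤ) • 1 := by
  have : Dynkin.E6.cartan = Matrix.of fun i j : Fin Dynkin.E6.card =>
      if i = j then (2 : ℤ) else if forkEdge 6 2 i j ∨ forkEdge 6 2 j i then -1 else 0 := by
    ext i j; simp only [cartan, Dynkin.edge, Matrix.of_apply]; congr
  rw [this]
  decide +kernel

theorem mul_cartan_E7 :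
    (show Matrix (Fin Dynkin.E7.card) (Fin Dynkin.E7.card) ℤ from
      !![4, 6, 8, 6, 4, 2, 4; 6, 12, 16, 12, 8, 4, 8; 8, 16, 24, 18, 12, 6, 12;
      6, 12, 18, 15, 10, 5, 9; 4, 8, 12, 10, 8, 4, 6; 2, 4, 6, 5, 4, 3, 3;
      4, 8, 12, 9, 6, 3, 7]) * Dynkin.E7.cartan = (2 : ℤ) • 1 := by
  have : Dynkin.E7.cartan = Matrix.of fun i j : Fin Dynkin.E7.card =>
      if i = j then (2 : ℤ) else if forkEdge 7 2 i j ∨ forkEdge 7 2 j i then -1 else 0 := by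
    ext i j; simp only [cartan, Dynkin.edge, Matrix.of_apply]; congr
  rw [this]
  decide +kernel

theorem mul_cartan_E8 :
    (show Matrix (Fin Dynkin.E8.card) (Fin Dynkin.E8.card) ℤ from
      !![4, 7, 10, 8, 6, 4, 2, 5; 7, 14, 20, 16, 12, 8, 4, 10; 10, 20, 30, 24, 18, 12, 6, 15;
      8, 16, 24, 20, 15, 10, 5, 12; 6, 12, 18, 15, 12, 8, 4, 9; 4, 8, 12, 10, 8, 6, 3, 6;
      2, 4, 6, 5, 4, 3, 2, 3; 5, 10, 15, 12, 9, 6, 3, 8]) *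
      Dynkin.E8.cartan = (1 : ℤ) • 1 := by
  have : Dynkin.E8.cartan = Matrix.of fun i j : Fin Dynkin.E8.card =>
      if i = j then (2 : ℤ) else if forkEdge 8 2 i j ∨ forkEdge 8 2 j i then -1 else 0 := by
    ext i j; simp only [cartan, Dynkin.edge, Matrix.of_apply]; congr
  rw [this]
  decide +kernel

/-- The Gram matrix of `𝔸_m` is congruent with that of no other Dynkin diagram. -/
theorem eq_A_of_zCongruent {m : ℕ} (hm : 2 ≤ m) (h1m : 1 ≤ m) (D : Dynkin)
    (h : ZCongruent (Dynkin.A m h1m).gram D.gram) : D = Dynkin.A m h1m := by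
  have hcard : m = D.card := by
    have := h.card_eq
    rwa [Fintype.card_fin, Fintype.card_fin] at this
  -- With equal ranks, `m + 1` would have to divide `4` with `m ≥ 4` in type `𝔻`, and `7 ∣ 3`, `8 ∣
  -- 2`, `9 ∣ 1` in the exceptional types.
  have key := dvd_of_zCongruent_A hm h1m D h
  cases D with
  | A k hk => simp only [Dynkin.card] at hcard; subst hcard; rfl
  | D k hk =>
    have := Int.le_of_dvd (by norm_num) (key 4 fun v => dvd_four_mul_of_cartan_D k hk _ v)
    simp only [Dynkin.card] at hcard
    omega
  | E6 =>
    have := key 3 fun v => dvd_mul_of_mul_cartan _ 3 _ mul_cartan_E6 _ v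
    simp only [Dynkin.card] at hcard
    subst hcard
    norm_num at this
  | E7 =>
    have := key 2 fun v => dvd_mul_of_mul_cartan _ 2 _ mul_cartan_E7 _ v
    simp only [Dynkin.card] at hcard
    subst hcard
    norm_num at this
  | E8 =>
    have := key 1 fun v => dvd_mul_of_mul_cartan _ 1 _ mul_cartan_E8 _ v
    simp only [Dynkin.card] at hcard
    subst hcard
    norm_num at this

/-- The usual root realisation: twice the Gram matrix is `R R^tr`, where the rows of `R` are the
vectors `ε_i - ε_{i+1}`. These are independent, as reading the coordinates from left to right shows.
-/
theorem posDef_gram_A (m : ℕ) (hm : 1 ≤ m) : (Dynkin.A m hm).gram.PosDef := by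
  have gA : ∀ i j : Fin (Dynkin.A m hm).card, (Dynkin.A m hm).gram i j =
      if i.val = j then 1 else if i.val + 1 = j ∨ j.val + 1 = i then -(1 / 2) else 0 := by
    intro i j
    rw [gram_apply]
    simp only [Fin.ext_iff, Dynkin.edge]
    congr
  generalize (Dynkin.A m hm).gram = G at gA ⊢
  generalize (Dynkin.A m hm).card = d at G gA
  set R : Matrix (Fin d) (Fin (d + 1)) ℚ :=
    Matrix.of fun i => Pi.single i.castSucc 1 - Pi.single i.succ 1 with hR
  have hG : G = (1 / 2 : ℚ) • (R * R.conjTranspose) := by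
    ext i j
    have : (R * R.conjTranspose) i j = (Pi.single i.castSucc 1 - Pi.single i.succ 1) ⬝ᵥ
        (Pi.single j.castSucc 1 - Pi.single j.succ 1) := by
      simp [Matrix.mul_apply, dotProduct, hR]
    rw [Matrix.smul_apply, this, gA]
    simp only [sub_dotProduct, single_dotProduct,
      Pi.single_apply, Pi.sub_apply, Fin.ext_iff, Fin.val_castSucc, Fin.val_succ, one_mul,
      smul_eq_mul]
    split_ifs <;> first | omega | norm_num
  rw [hG]
  refine Matrix.PosDef.smul (Matrix.PosDef.mul_conjTranspose_self R ?_) (by norm_num)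
  refine (injective_iff_map_eq_zero R.vecMulLinear).2 fun x hx => ?_
  have hrec : ∀ j : Fin (d + 1), ∑ i, (x i * (if j = i.castSucc then 1 else 0) -
      x i * (if j = i.succ then 1 else 0)) = 0 := by
    intro j
    simpa [Matrix.vecMulLinear_apply, Matrix.vecMul, dotProduct, hR, Pi.single_apply, mul_sub]
      using congrFun hx j
  have hzero : ∀ k (hk : k < d), x ⟨k, hk⟩ = 0 := by
    intro k
    induction k with
    | zero =>
      intro hk
      have := hrec ⟨0, by omega⟩
      rw [Finset.sum_eq_single ⟨0, hk⟩ (fun b _ hb => by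
        have : (0 : ℕ) ≠ b := fun e => hb (Fin.ext e.symm)
        simp [Fin.ext_iff, this]) (by simp)] at this
      simpa [Fin.ext_iff] using this
    | succ k ih =>
      intro hk
      have := hrec ⟨k + 1, by omega⟩
      rw [Finset.sum_eq_single ⟨k + 1, hk⟩ (fun b _ hb => by
        have h1 : k + 1 ≠ b := fun e => hb (Fin.ext e.symm)
        by_cases h2 : k = b
        · have := ih (by omega)
          simp only [h2] at this
          simp [this]
        · simp [Fin.ext_iff, h1, h2]) (by simp)] at this
      simpa [Fin.ext_iff] using this
  exact funext fun k => hzero k k.2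

end Dynkin

/-! ### Unimodularity of the incidence matrix, and the explicit order -/

theorem incMatrix_apply (α : Type*) [Fintype α] [DecidableEq α] [PartialOrder α] (i j : α)
    [Decidable (i ≤ j)] : incMatrix α i j = if i ≤ j then 1 else 0 := by
  simp only [incMatrix, Matrix.of_apply]
  congr

/-- Along a linear extension the incidence matrix is upper triangular with unit diagonal. -/
theorem det_incMatrix_of_strictMono {α : Type*} [Fintype α] [DecidableEq α] [PartialOrder α]
    (b : α → ℕ) (hb : Function.Injective b) (hm : ∀ x y : α, x ≤ y → b x ≤ b y) :
    (incMatrix α).det = 1 := by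
  classical
  have hT : (incMatrix α).BlockTriangular b := by
    intro i j h
    rw [incMatrix_apply, if_neg]
    exact fun hij => absurd (hm i j hij) (by omega)
  rw [hT.det]
  refine Finset.prod_eq_one fun a ha => ?_
  obtain ⟨x, -, rfl⟩ := Finset.mem_image.1 ha
  have : Subsingleton {y : α // b y = b x} :=
    ⟨fun y z => Subtype.ext (hb (y.2.trans z.2.symm))⟩
  rw [Matrix.det_eq_elem_of_subsingleton _ ⟨x, rfl⟩]
  simp [Matrix.toSquareBlock, Matrix.toSquareBlockProp, incMatrix_apply]

namespace TwoPeak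

/-- The order relation of the two-peak poset on the underlying numbers. -/
def LeVal (n p i j : ℕ) : Prop :=
  i = j ∨ (i < j ∧
    (((i = 1 ∨ 3 ≤ i ∧ i ≤ p) ∧ (3 ≤ j ∧ j ≤ p ∨ j = n)) ∨
     ((i = 2 ∨ p + 1 ≤ i ∧ i ≤ n - 2) ∧ (p + 1 ≤ j ∧ j ≤ n - 2 ∨ j = n)) ∨
     ((i = 1 ∨ i = 2) ∧ j = n - 1)))

instance (n p i j : ℕ) : Decidable (LeVal n p i j) := by
  unfold LeVal; infer_instance

section

variable {n p : ℕ}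

theorem val_pos (x : TwoPeak n p) : 1 ≤ x.val := (Finset.mem_Icc.1 x.2).1

theorem val_le (x : TwoPeak n p) : x.val ≤ n := (Finset.mem_Icc.1 x.2).2

/-- The element `k` of the poset. -/
def el {k : ℕ} (hk : 1 ≤ k ∧ k ≤ n) : TwoPeak n p := ⟨k, Finset.mem_Icc.2 hk⟩

@[simp] theorem el_val {k : ℕ} (hk : 1 ≤ k ∧ k ≤ n) : (el hk : TwoPeak n p).val = k := rfl

theorem ext_val {x y : TwoPeak n p} (h : x.val = y.val) : x = y := Subtype.ext h

theorem card_eq : Fintype.card (TwoPeak n p) = n := by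
  have : Fintype.card (TwoPeak n p) = (Finset.Icc 1 n).card := Fintype.card_coe _
  simpa using this

theorem le_of_leVal (hp : n ≤ 2 * p) (hpn : p + 2 ≤ n) (x y : TwoPeak n p)
    (h : LeVal n p x.val y.val) : x ≤ y := by
  induction hk : y.val - x.val using Nat.strong_induction_on generalizing x with
  | _ k ih =>
    have hx := x.val_pos
    have hx' := x.val_le
    have hy := y.val_le
    rcases h with h | ⟨hlt, h⟩
    · exact (ext_val h : x = y) ▸ le_rfl
    -- The induction is on `y.val - x.val`: the first arrow of the path leads to some `s` that is
    -- still below `y` and nearer to it.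
    have step : ∀ s, Arrow n p x.val s → s ≤ y.val → LeVal n p s y.val → x ≤ y := by
      intro s hs hsy hle
      have h1 := hs.1
      refine le_trans (b := (el (k := s) ⟨by omega, by omega⟩ : TwoPeak n p))
        (Relation.ReflTransGen.single hs) (ih _ ?_ _ hle rfl)
      rw [el_val]
      omega
    rcases h with h | h | h
    · by_cases h1 : x.val = 1
      · by_cases h3 : 3 ≤ p
        · exact step 3 (by unfold Arrow; split_ifs <;> omega) (by omega)
            (by unfold LeVal; omega)
        · exact step n (by unfold Arrow; split_ifs <;> omega) (by omega)
            (by unfold LeVal; omega)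
      · by_cases h3 : x.val < p
        · exact step (x.val + 1) (by unfold Arrow; split_ifs <;> omega) (by omega)
            (by unfold LeVal; omega)
        · exact step n (by unfold Arrow; split_ifs <;> omega) (by omega)
            (by unfold LeVal; omega)
    · by_cases h1 : x.val = 2
      · by_cases h3 : p + 1 ≤ n - 2
        · exact step (p + 1) (by unfold Arrow; split_ifs <;> omega) (by omega)
            (by unfold LeVal; omega)
        · exact step n (by unfold Arrow; split_ifs <;> omega) (by omega)
            (by unfold LeVal; omega)
      · by_cases h3 : x.val < n - 2
        · exact step (x.val + 1) (by unfold Arrow; split_ifs <;> omega) (by omega)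
            (by unfold LeVal; omega)
        · exact step n (by unfold Arrow; split_ifs <;> omega) (by omega)
            (by unfold LeVal; omega)
    · exact step (n - 1) (by unfold Arrow; split_ifs <;> omega) (by omega)
        (by unfold LeVal; omega)

theorem le_iff (hp : n ≤ 2 * p) (hpn : p + 2 ≤ n) (x y : TwoPeak n p) :
    x ≤ y ↔ LeVal n p x.val y.val := by
  refine ⟨fun h => ?_, le_of_leVal hp hpn x y⟩
  rcases Le.explicit hp hpn h with rfl | h
  · exact Or.inl rfl
  · exact Or.inr h

theorem isUnit_det_incMatrix : IsUnit (incMatrix (TwoPeak n p)).det := by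
  rw [det_incMatrix_of_strictMono (fun x : TwoPeak n p => x.val) Subtype.val_injective
    fun _ _ h => Le.val_le h]
  exact isUnit_one

/-- The standard basis vector of the element `k`. -/
def ev (n p k : ℕ) : TwoPeak n p → ℤ := fun x => if x.val = k then 1 else 0

theorem ev_eq_single {k : ℕ} (hk : 1 ≤ k ∧ k ≤ n) :
    ev n p k = Pi.single (el hk : TwoPeak n p) 1 := by
  ext x
  simp only [ev, Pi.single_apply]
  exact if_congr ⟨fun h => ext_val h, fun h => congrArg Subtype.val h⟩ rfl rfl

theorem single_eq_ev (x : TwoPeak n p) : Pi.single x 1 = ev n p x.val :=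
  (ev_eq_single ⟨x.val_pos, x.val_le⟩).symm

theorem ev_vecMul_incMatrix (hp : n ≤ 2 * p) (hpn : p + 2 ≤ n) {k : ℕ} (hk : 1 ≤ k ∧ k ≤ n) :
    Matrix.vecMul (ev n p k) (incMatrix (TwoPeak n p)) =
      fun x => if LeVal n p k x.val then 1 else 0 := by
  classical
  ext x
  rw [ev_eq_single hk, Matrix.single_one_vecMul, Matrix.row_apply, incMatrix_apply, le_iff hp hpn]
  congr

theorem ev_vecMul_incMatrix_transpose (hp : n ≤ 2 * p) (hpn : p + 2 ≤ n) {k : ℕ}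
    (hk : 1 ≤ k ∧ k ≤ n) :
    Matrix.vecMul (ev n p k) (incMatrix (TwoPeak n p)).transpose =
      fun x => if LeVal n p x.val k then 1 else 0 := by
  classical
  ext x
  rw [ev_eq_single hk, Matrix.single_one_vecMul, Matrix.row_apply, Matrix.transpose_apply,
    incMatrix_apply, le_iff hp hpn]
  congr

theorem kerVec_eq (hn : 4 ≤ n) :
    kerVec n p = ev n p (n - 1) + ev n p n - ev n p 1 - ev n p 2 := by
  ext x
  simp only [kerVec, ev, Pi.add_apply, Pi.sub_apply]
  split_ifs <;> omega

end

end TwoPeak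

/-! ### Forms that become positive definite off a radical vector -/

section Radical

variable {ι κ : Type*} [Fintype ι] [DecidableEq ι] [Fintype κ] [DecidableEq κ]

/-- Clearing the coordinate `z` along `d` does not change `X`, so `X` factors through the complement
of `z`, and from there through `Y` by the congruence. The latter is invertible, so the factor `W`
kills only what clearing kills, namely the multiples of `d`. -/
theorem exists_factor_of_radical (X : Matrix ι ι ℚ) (hX : X.transpose = X) (d : ι → ℤ)
    (hd : X.mulVec (fun i => (d i : ℚ)) = 0) {z : ι} (hz : d z * d z = 1) {K : Finset ι}
    (hK : K = {z}) (Y : Matrix κ κ ℚ)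
    (hY : ZCongruent (X.submatrix (fun i : {i : ι // i ∉ K} => i.val)
      (fun i : {i : ι // i ∉ K} => i.val)) Y) :
    ∃ W : Matrix κ ι ℚ, X = W.transpose * Y * W ∧
      ∀ x : ι → ℚ, W.mulVec x = 0 → x = (d z * x z : ℚ) • fun i => (d i : ℚ) := by
  obtain ⟨B', B, h₁, h₂, h₃⟩ := hY.symm
  set c := (clearMatrix d z).map (Int.cast : ℤ → ℚ) with hc
  have hrow : ∀ j, c z j = 0 := fun j => by simp [hc, clearMatrix_row d hz]
  set P : Matrix {i : ι // i ∉ K} ι ℚ := c.submatrix (fun i => i.val) id with hP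
  refine ⟨B'.map (Int.cast : ℤ → ℚ) * P, ?_, ?_⟩
  · calc X = c.transpose * X * c := by
          rw [transpose_clearMatrix_mul X hX d hd, mul_clearMatrix X d hd]
      _ = P.transpose * X.submatrix (fun i : {i : ι // i ∉ K} => i.val)
            (fun i : {i : ι // i ∉ K} => i.val) * P := by
          rw [hP, Matrix.transpose_submatrix,
            submatrix_mul_submatrix_compl hK _ _ fun i j => by
              rw [Matrix.transpose_apply, hrow, zero_mul],
            submatrix_mul_submatrix_compl hK _ _ fun i j => by rw [hrow, mul_zero],
            Matrix.submatrix_id_id]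
      _ = _ := by
          rw [← h₃]
          simp only [Matrix.transpose_mul, Matrix.mul_assoc]
  · intro x hx
    have hPx : P.mulVec x = 0 := by
      have h₄ : B.map (Int.cast : ℤ → ℚ) * B'.map (Int.cast : ℤ → ℚ) = 1 := by
        rw [← intCast_map_mul, h₂, intCast_map_one]
      calc P.mulVec x = (B.map (Int.cast : ℤ → ℚ)).mulVec
            ((B'.map (Int.cast : ℤ → ℚ) * P).mulVec x) := by
              rw [Matrix.mulVec_mulVec, ← Matrix.mul_assoc, h₄, Matrix.one_mul]
        _ = 0 := by rw [hx, Matrix.mulVec_zero]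
    ext i
    have hz' : (d z : ℚ) * d z = 1 := by exact_mod_cast hz
    by_cases hi : i = z
    · subst hi
      simp only [Pi.smul_apply, smul_eq_mul]
      linear_combination -x i * hz'
    · have := congrFun hPx ⟨i, by simpa [hK] using hi⟩
      simp [hP, hc, clearMatrix, Matrix.mulVec, dotProduct, Matrix.vecMulVec_apply, sub_mul,
        Matrix.one_apply, Pi.single_apply] at this
      simp only [Pi.smul_apply, smul_eq_mul]
      linear_combination this

/-- A symmetric form with a radical vector that is a unit at `z`, and whose restriction to the
complement of `z` is congruent with a positive definite form, is non-negative of corank one. -/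
theorem nonneg_of_radical (X : Matrix ι ι ℚ) (hX : X.transpose = X) (d : ι → ℤ)
    (hd : X.mulVec (fun i => (d i : ℚ)) = 0) {z : ι} (hz : d z * d z = 1) {K : Finset ι}
    (hK : K = {z}) (Y : Matrix κ κ ℚ) (hYpos : Y.PosDef)
    (hY : ZCongruent (X.submatrix (fun i : {i : ι // i ∉ K} => i.val)
      (fun i : {i : ι // i ∉ K} => i.val)) Y) :
    X.PosSemidef ∧ X.rank + 1 = Fintype.card ι ∧
      ∀ x : ι → ℚ, x ⬝ᵥ X.mulVec x = 0 → x = (d z * x z : ℚ) • fun i => (d i : ℚ) := by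
  obtain ⟨W, hW, hker⟩ := exists_factor_of_radical X hX d hd hz hK Y hY
  have hnull : ∀ x : ι → ℚ, x ⬝ᵥ X.mulVec x = 0 → x = (d z * x z : ℚ) • fun i => (d i : ℚ) := by
    intro x hx
    apply hker
    by_contra hne
    -- The value of `X` at `x` is the value of `Y` at `W x`, which would be positive.
    have hpos := hYpos.dotProduct_mulVec_pos hne
    rw [hW, ← Matrix.mulVec_mulVec, ← Matrix.mulVec_mulVec, Matrix.dotProduct_mulVec,
      Matrix.vecMul_transpose] at hx
    rw [star_trivial, hx] at hpos
    exact lt_irrefl _ hpos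
  refine ⟨?_, ?_, hnull⟩
  · rw [hW]
    exact hYpos.posSemidef.conjTranspose_mul_mul_same W
  · have hk : LinearMap.ker X.mulVecLin = Submodule.span ℚ {fun i => (d i : ℚ)} := by
      ext x
      rw [LinearMap.mem_ker, Matrix.mulVecLin_apply, Submodule.mem_span_singleton]
      constructor
      · intro hx
        exact ⟨_, (hnull x (by rw [hx, dotProduct_zero])).symm⟩
      · rintro ⟨a, rfl⟩
        rw [Matrix.mulVec_smul, hd, smul_zero]
    have hne : (fun i => (d i : ℚ)) ≠ 0 := by
      intro h
      have h' : (d z : ℚ) = 0 := congrFun h z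
      have h'' : d z = 0 := by exact_mod_cast h'
      rw [h''] at hz
      norm_num at hz
    have := X.mulVecLin.finrank_range_add_finrank_ker
    rw [hk, finrank_span_singleton hne, Module.finrank_fintype_fun_eq_card] at this
    exact this

end Radical

theorem gramMatrix_subtype {α : Type*} [Fintype α] [DecidableEq α] [PartialOrder α]
    (K : Finset α) : gramMatrix {i : α // i ∉ K} =
      (gramMatrix α).submatrix (fun i : {i : α // i ∉ K} => i.val)
        (fun i : {i : α // i ∉ K} => i.val) := by
  classical
  ext i j
  simp [gramMatrix, incMatrix_apply]

theorem gramMatrix_transpose (α : Type*) [Fintype α] [DecidableEq α] [PartialOrder α] :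
    (gramMatrix α).transpose = gramMatrix α := by
  ext i j
  simp [gramMatrix, add_comm]

theorem quadForm_eq_gram {α : Type*} [Fintype α] [DecidableEq α] [PartialOrder α] (x : α → ℤ) :
    (quadForm α x : ℚ) = (fun i => (x i : ℚ)) ⬝ᵥ (gramMatrix α).mulVec (fun i => (x i : ℚ)) := by
  have h1 : ∀ M : Matrix α α ℤ, ((x ⬝ᵥ M.mulVec x : ℤ) : ℚ) =
      (fun i => (x i : ℚ)) ⬝ᵥ (M.map (Int.cast : ℤ → ℚ)).mulVec (fun i => (x i : ℚ)) := by
    intro M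
    simp [dotProduct, Matrix.mulVec]
  have h2 : x ⬝ᵥ (incMatrix α).transpose.mulVec x = x ⬝ᵥ (incMatrix α).mulVec x := by
    rw [Matrix.mulVec_transpose, dotProduct_comm, ← Matrix.dotProduct_mulVec]
  rw [gramMatrix, Matrix.smul_mulVec, dotProduct_smul, ← h1, Matrix.add_mulVec, dotProduct_add,
    h2, quadForm, bilinForm]
  push_cast
  rw [smul_eq_mul]
  ring

/-! ### Reduction to `𝔸_{n-1}`, the kernel, and the Dynkin type -/

namespace TwoPeak

variable {n p : ℕ}

theorem LeVal.le {n p i j : ℕ} (h : LeVal n p i j) : i ≤ j := by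
  rcases h with h | h
  · exact h.le
  · exact h.1.le

/-- Away from `n - 1` each element other than `n` has a single upper cover, so its up-set is itself
together with the up-set of that cover. -/
theorem leVal_iff_of_arrow (hp : n ≤ 2 * p) (hpn : p + 2 ≤ n) {a b x : ℕ} (h : Arrow n p a b)
    (hb : b ≠ n - 1) (hx : x ≠ n - 1) : LeVal n p a x ↔ x = a ∨ LeVal n p b x := by
  obtain ⟨hab, h⟩ := h
  rcases h with ⟨rfl, h⟩ | ⟨h1, h2, h⟩ | ⟨h1, h2, h⟩ | ⟨rfl, h⟩ | ⟨h1, h2, h⟩ | ⟨h1, h2, h⟩ | h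
  · split_ifs at h
    · subst h; unfold LeVal; omega
    · subst h; unfold LeVal; omega
  · subst h; unfold LeVal; omega
  · subst h2; subst h; unfold LeVal; omega
  · split_ifs at h
    · subst h; unfold LeVal; omega
    · subst h; unfold LeVal; omega
  · subst h; unfold LeVal; omega
  · subst h; unfold LeVal; omega
  · omega

/-- Dually, an element other than `n - 1` and `n` has at most one lower cover. -/
theorem leVal_iff_of_arrow' (hp : n ≤ 2 * p) (hpn : p + 2 ≤ n) {a b x : ℕ} (h : Arrow n p a b)
    (hb : b < n - 1) : LeVal n p x b ↔ x = b ∨ LeVal n p x a := by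
  obtain ⟨hab, h⟩ := h
  rcases h with ⟨rfl, h⟩ | ⟨h1, h2, h⟩ | ⟨h1, h2, h⟩ | ⟨rfl, h⟩ | ⟨h1, h2, h⟩ | ⟨h1, h2, h⟩ | h
  · split_ifs at h
    · subst h; unfold LeVal; omega
    · subst h; unfold LeVal; omega
  · subst h; unfold LeVal; omega
  · subst h2; subst h; unfold LeVal; omega
  · split_ifs at h
    · subst h; unfold LeVal; omega
    · subst h; unfold LeVal; omega
  · subst h; unfold LeVal; omega
  · subst h; unfold LeVal; omega
  · omega

theorem indicator_up_sub (hp : n ≤ 2 * p) (hpn : p + 2 ≤ n) {a b x : ℕ} (h : Arrow n p a b)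
    (hb : b ≠ n - 1) (hx : x ≠ n - 1) :
    (if LeVal n p a x then (1 : ℤ) else 0) - (if LeVal n p b x then 1 else 0) =
      if x = a then 1 else 0 := by
  have h1 := leVal_iff_of_arrow hp hpn h hb hx
  have h2 : x = a → ¬ LeVal n p b x := fun e h' => by have := h'.le; have := h.1; omega
  by_cases hxa : x = a <;> by_cases hxb : LeVal n p b x <;> simp_all

theorem indicator_down_sub (hp : n ≤ 2 * p) (hpn : p + 2 ≤ n) {a b x : ℕ} (h : Arrow n p a b)
    (hb : b < n - 1) :
    (if LeVal n p x b then (1 : ℤ) else 0) - (if LeVal n p x a then 1 else 0) =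
      if x = b then 1 else 0 := by
  have h1 := leVal_iff_of_arrow' (x := x) hp hpn h hb
  have h2 : x = b → ¬ LeVal n p x a := fun e h' => by have := h'.le; have := h.1; omega
  by_cases hxa : x = b <;> by_cases hxb : LeVal n p x a <;> simp_all

/-- The enumeration `1, 3, …, p, n, n - 2, …, p + 1, 2, n - 1` of the Hasse cycle. -/
def cyc (n p k : ℕ) : ℕ :=
  if k = 1 then 1 else if k < p then k + 1 else if k = p then n else if k ≤ n - 2 then n - 1 + p - k
  else if k = n - 1 then 2 else if k = n then n - 1 else 1

theorem cyc_spec (n p k : ℕ) (hp : n ≤ 2 * p) (hpn : p + 2 ≤ n) (h1 : 1 ≤ k) (h2 : k ≤ n) :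
    (k = 1 ∧ cyc n p k = 1) ∨ (1 < k ∧ k < p ∧ cyc n p k = k + 1) ∨ (k = p ∧ cyc n p k = n) ∨
      (p < k ∧ k ≤ n - 2 ∧ cyc n p k + k = n - 1 + p) ∨ (k = n - 1 ∧ cyc n p k = 2) ∨
      (k = n ∧ cyc n p k = n - 1) := by
  unfold cyc
  split_ifs <;> omega

/-- The position preceding the position `k` in the order given by the path
`1, 3, …, p, n, n - 2, …, p + 1, 2` oriented towards `n`. -/
def nxt (p k : ℕ) : ℕ := if k < p then k + 1 else k - 1

/-- The basis vectors of the complement of `n - 1` that form a Dynkin diagram `𝔸_{n-1}`. -/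
def pathVec (n p k : ℕ) : TwoPeak n p → ℤ :=
  if k = p then ev n p n else ev n p (cyc n p k) - ev n p (cyc n p (nxt p k))

theorem cyc_one (n p : ℕ) : cyc n p 1 = 1 := if_pos rfl

theorem cyc_up {k : ℕ} (h1 : 1 < k) (h2 : k < p) : cyc n p k = k + 1 := by
  rw [cyc, if_neg h1.ne', if_pos h2]

theorem cyc_top (h : 1 < p) : cyc n p p = n := by
  rw [cyc, if_neg h.ne', if_neg (lt_irrefl _), if_pos rfl]

theorem cyc_down {k : ℕ} (h : 1 < k) (h1 : p < k) (h2 : k ≤ n - 2) :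
    cyc n p k = n - 1 + p - k := by
  rw [cyc, if_neg h.ne', if_neg h1.not_gt, if_neg h1.ne', if_pos h2]

theorem cyc_two (h : 1 < p) (hpn : p + 2 ≤ n) : cyc n p (n - 1) = 2 := by
  rw [cyc, if_neg (by omega), if_neg (by omega), if_neg (by omega), if_neg (by omega), if_pos rfl]

theorem arrow_cyc_succ (hpn : p + 2 ≤ n) {k : ℕ} (h1 : 1 ≤ k) (h2 : k < p) :
    Arrow n p (cyc n p k) (cyc n p (k + 1)) := by
  rcases h1.eq_or_lt with rfl | h1
  · rw [cyc_one]
    rcases (show 1 + 1 ≤ p from h2).eq_or_lt with h | h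
    · rw [h, cyc_top (by omega)]
      exact ⟨by omega, Or.inl ⟨rfl, by rw [if_neg (by omega)]⟩⟩
    · rw [cyc_up (by omega) h]
      exact ⟨by omega, Or.inl ⟨rfl, by rw [if_pos (by omega)]⟩⟩
  · rw [cyc_up h1 h2]
    rcases (show k + 1 ≤ p from h2).eq_or_lt with h | h
    · rw [h, cyc_top (by omega)]
      exact ⟨by omega, Or.inr (Or.inr (Or.inl ⟨by omega, rfl, rfl⟩))⟩
    · rw [cyc_up (by omega) h]
      exact ⟨by omega, Or.inr (Or.inl ⟨by omega, by omega, rfl⟩)⟩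

theorem arrow_cyc_pred (hp : 1 < p) (hpn : p + 2 ≤ n) {k : ℕ} (h1 : p < k) (h2 : k < n) :
    Arrow n p (cyc n p k) (cyc n p (k - 1)) := by
  rcases (show k ≤ n - 1 by omega).eq_or_lt with rfl | h2
  · rw [cyc_two hp hpn]
    rcases (show p ≤ n - 1 - 1 by omega).eq_or_lt with h | h
    · rw [← h, cyc_top hp]
      exact ⟨by omega, Or.inr (Or.inr (Or.inr (Or.inl ⟨rfl, by rw [if_neg (by omega)]⟩)))⟩
    · rw [cyc_down (by omega) h (by omega)]
      exact ⟨by omega, Or.inr (Or.inr (Or.inr (Or.inl ⟨rfl, by rw [if_pos (by omega)]; omega⟩)))⟩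
  · rw [cyc_down (by omega) h1 (by omega)]
    rcases (show p ≤ k - 1 by omega).eq_or_lt with h | h
    · rw [← h, cyc_top hp]
      exact ⟨by omega, Or.inr (Or.inr (Or.inr (Or.inr (Or.inr (Or.inl
        ⟨by omega, by omega, rfl⟩)))))⟩
    · rw [cyc_down (by omega) h (by omega)]
      exact ⟨by omega, Or.inr (Or.inr (Or.inr (Or.inr (Or.inl
        ⟨by omega, by omega, by omega⟩))))⟩

theorem cyc_mem (hp : n ≤ 2 * p) (hpn : p + 2 ≤ n) {k : ℕ} (h1 : 1 ≤ k) (h2 : k ≤ n) :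
    1 ≤ cyc n p k ∧ cyc n p k ≤ n := by
  have := cyc_spec n p k hp hpn h1 h2
  omega

theorem cyc_ne (hp : n ≤ 2 * p) (hpn : p + 2 ≤ n) {k : ℕ} (h1 : 1 ≤ k) (h2 : k < n) :
    cyc n p k ≠ n - 1 := by
  have := cyc_spec n p k hp hpn h1 h2.le
  omega

theorem cyc_inj (hp : n ≤ 2 * p) (hpn : p + 2 ≤ n) {k l : ℕ} (h1 : 1 ≤ k) (h2 : k ≤ n)
    (h3 : 1 ≤ l) (h4 : l ≤ n) (h : cyc n p k = cyc n p l) : k = l := by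
  have s1 := cyc_spec n p k hp hpn h1 h2
  have s2 := cyc_spec n p l hp hpn h3 h4
  omega

/-- Rows of the incidence matrix are indicators of up-sets, and those of the two ends of an arrow
differ by one element. So, off `n - 1`, the vectors `pathVec` are the rows of the inverse incidence
matrix. -/
theorem pathVec_vecMul (hp : n ≤ 2 * p) (hpn : p + 2 ≤ n) {k : ℕ} (h1 : 1 ≤ k) (h2 : k < n)
    (x : TwoPeak n p) (hx : x.val ≠ n - 1) :
    Matrix.vecMul (pathVec n p k) (incMatrix (TwoPeak n p)) x =
      if x.val = cyc n p k then 1 else 0 := by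
  unfold pathVec nxt
  rcases lt_trichotomy k p with hk | hk | hk
  · rw [if_neg hk.ne, if_pos hk, Matrix.sub_vecMul,
      ev_vecMul_incMatrix hp hpn (cyc_mem hp hpn h1 h2.le),
      ev_vecMul_incMatrix hp hpn (cyc_mem hp hpn (by omega) h2)]
    exact indicator_up_sub hp hpn (arrow_cyc_succ hpn h1 hk)
      (cyc_ne hp hpn (by omega) (by omega)) hx
  · subst hk
    have hx1 := x.val_le
    rw [if_pos rfl, ev_vecMul_incMatrix hp hpn (by omega), cyc_top (by omega)]
    exact if_congr ⟨fun h => by have := h.le; omega, fun h => Or.inl h.symm⟩ rfl rfl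
  · rw [if_neg hk.ne', if_neg hk.le.not_gt, Matrix.sub_vecMul,
      ev_vecMul_incMatrix hp hpn (cyc_mem hp hpn h1 h2.le),
      ev_vecMul_incMatrix hp hpn (cyc_mem hp hpn (by omega) (by omega))]
    exact indicator_up_sub hp hpn (arrow_cyc_pred (by omega) hpn hk h2)
      (cyc_ne hp hpn (by omega) (by omega)) hx

theorem pathVec_apply (hp : n ≤ 2 * p) (hpn : p + 2 ≤ n) {k l : ℕ} (h1 : 1 ≤ k) (h2 : k < n)
    (h3 : 1 ≤ l) (h4 : l < n) :
    pathVec n p k (el (cyc_mem hp hpn h3 h4.le)) =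
      if l = k then 1 else if k ≠ p ∧ l = nxt p k then -1 else 0 := by
  have hpp : cyc n p p = n := cyc_top (by omega)
  have hc : ∀ j, 1 ≤ j → j < n → (cyc n p l = cyc n p j ↔ l = j) := fun j hj hj' =>
    ⟨cyc_inj hp hpn h3 h4.le hj hj'.le, fun e => by rw [e]⟩
  unfold pathVec
  by_cases hk : k = p
  · have := hc p (by omega) (by omega)
    rw [hpp] at this
    simp [ev, hk, this]
  · have hn : (k < p ∧ nxt p k = k + 1) ∨ (p < k ∧ nxt p k = k - 1) := by
      unfold nxt; split_ifs <;> omega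
    simp only [hk, ev, if_false, Pi.sub_apply, el_val, hc k h1 h2,
      hc (nxt p k) (by omega) (by omega)]
    split_ifs <;> omega

theorem pathVec_el (hp : n ≤ 2 * p) (hpn : p + 2 ≤ n) {k : ℕ} (h1 : 1 ≤ k) (h2 : k < n)
    (x : TwoPeak n p) (hx : x.val = n - 1) : pathVec n p k x = 0 := by
  have s1 := cyc_ne hp hpn h1 h2
  unfold pathVec ev
  split_ifs with h
  · exact if_neg (by omega)
  · have s2 := cyc_ne hp hpn (k := nxt p k) (by unfold nxt; split_ifs <;> omega)
      (by unfold nxt; split_ifs <;> omega)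
    simp [hx, s1.symm, s2.symm]

/-- With `F` the matrix whose columns are the vectors `pathVec`, the product `F^tr C` consists of
unit vectors off `n - 1`. This makes `F` invertible there, and it reduces `F^tr C F` to the entries
of `F`: `1` on the diagonal and one `-1` for each arrow. Symmetrising gives the Cartan matrix of the
path. -/
theorem zCongruent_compl (hp : n ≤ 2 * p) (hpn : p + 2 ≤ n) (K : Finset (TwoPeak n p))
    (hK : K = {el (k := n - 1) ⟨by omega, by omega⟩}) (h1 : 1 ≤ n - 1) :
    ZCongruent ((gramMatrix (TwoPeak n p)).submatrix
      (fun i : {i : TwoPeak n p // i ∉ K} => i.val)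
      (fun i : {i : TwoPeak n p // i ∉ K} => i.val)) (Dynkin.A (n - 1) h1).gram := by
  have hlt : ∀ i : Fin (Dynkin.A (n - 1) h1).card, i.val + 1 < n := fun i => by
    have : i.val < n - 1 := i.2
    omega
  set z : TwoPeak n p := el (k := n - 1) ⟨by omega, by omega⟩ with hz
  set A : Fin (Dynkin.A (n - 1) h1).card → TwoPeak n p := fun i =>
    el (cyc_mem hp hpn (k := i.val + 1) (by omega) (hlt i).le) with hA
  set F : Matrix (TwoPeak n p) (Fin (Dynkin.A (n - 1) h1).card) ℤ :=
    Matrix.of fun x i => pathVec n p (i.val + 1) x with hF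
  have hFz : ∀ j, F z j = 0 := fun j => pathVec_el hp hpn (by omega) (hlt j) z rfl
  have hFC : ∀ i x, x ≠ z → (F.transpose * incMatrix (TwoPeak n p)) i x =
      if x = A i then 1 else 0 := by
    intro i x hx
    refine (pathVec_vecMul hp hpn (by omega) (hlt i) x fun e => hx (ext_val e)).trans ?_
    exact if_congr ⟨fun h => ext_val h, fun h => congrArg Subtype.val h⟩ rfl rfl
  have hM : ∀ i j, (F.transpose * incMatrix (TwoPeak n p) * F) i j = F (A i) j := by
    intro i j
    rw [Matrix.mul_apply, Finset.sum_eq_single (A i)]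
    · rw [hFC i _ fun e => cyc_ne hp hpn (by omega) (hlt i) (congrArg Subtype.val e), if_pos rfl,
        one_mul]
    · intro x _ hx
      by_cases hxz : x = z
      · rw [hxz, hFz, mul_zero]
      · rw [hFC i x hxz, if_neg hx, zero_mul]
    · simp
  have hcard : Fintype.card {i : TwoPeak n p // i ∉ K} =
      Fintype.card (Fin (Dynkin.A (n - 1) h1).card) := by
    rw [Fintype.card_fin, Fintype.card_subtype_compl (p := fun i => i ∈ K), card_eq, hK]
    simp [Dynkin.card]
  have hinv : (((incMatrix (TwoPeak n p)).submatrix id A).transpose.submatrix id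
      (fun i : {i : TwoPeak n p // i ∉ K} => i.val)) *
      F.submatrix (fun i : {i : TwoPeak n p // i ∉ K} => i.val) id = 1 := by
    rw [submatrix_mul_submatrix_compl hK _ _ fun i j => by rw [hFz, mul_zero]]
    ext i j
    have := hFC j (A i) fun e => cyc_ne hp hpn (by omega) (hlt i) (congrArg Subtype.val e)
    rw [Matrix.mul_apply] at this
    rw [Matrix.submatrix_id_id, Matrix.mul_apply, Matrix.one_apply]
    refine (Finset.sum_congr rfl fun x _ => ?_).trans (this.trans ?_)
    · simp [mul_comm]
    · refine if_congr ⟨fun h => ?_, fun h => by rw [h]⟩ rfl rfl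
      have := cyc_inj hp hpn (by omega) (hlt i).le (by omega) (hlt j).le
        (congrArg Subtype.val h)
      exact Fin.ext (by omega)
  refine ⟨F.submatrix (fun i => i.val) id, _,
    (Matrix.mul_eq_one_comm_of_card_eq _ _ _ hcard).2 hinv, hinv, ?_⟩
  rw [← Matrix.submatrix_map, Matrix.transpose_submatrix,
    submatrix_mul_submatrix_compl hK _ _ fun i j => by
      rw [Matrix.transpose_apply, Matrix.map_apply, hFz, Int.cast_zero, zero_mul],
    submatrix_mul_submatrix_compl hK _ _ fun i j => by
      rw [Matrix.map_apply, hFz, Int.cast_zero, mul_zero], Matrix.submatrix_id_id]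
  have hint : F.transpose * (incMatrix (TwoPeak n p) + (incMatrix (TwoPeak n p)).transpose) * F =
      (Dynkin.A (n - 1) h1).cartan := by
    have ht : F.transpose * (incMatrix (TwoPeak n p)).transpose * F =
        (F.transpose * incMatrix (TwoPeak n p) * F).transpose := by
      simp only [Matrix.transpose_mul, Matrix.transpose_transpose, Matrix.mul_assoc]
    rw [Matrix.mul_add, Matrix.add_mul, ht]
    ext i j
    have hi := hlt i
    have hj := hlt j
    rw [Matrix.add_apply, Matrix.transpose_apply, hM, hM]
    simp only [hF, hA, Matrix.of_apply, Dynkin.cartan, Dynkin.edge, Fin.ext_iff]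
    rw [pathVec_apply hp hpn (by omega) hj (by omega) hi,
      pathVec_apply hp hpn (by omega) hi (by omega) hj]
    unfold nxt
    split_ifs <;> omega
  have h2 : (Dynkin.A (n - 1) h1).gram = (1 / 2 : ℚ) • ((2 : ℚ) • (Dynkin.A (n - 1) h1).gram) := by
    rw [smul_smul]; norm_num
  rw [h2, ← Dynkin.cartan_map, ← hint, gramMatrix, Matrix.mul_smul, Matrix.smul_mul,
    intCast_map_mul, intCast_map_mul, Matrix.transpose_map]

theorem kerVec_vecMul (hp : n ≤ 2 * p) (hpn : p + 2 ≤ n) :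
    Matrix.vecMul (kerVec n p) (incMatrix (TwoPeak n p)) = fun _ => -1 := by
  ext x
  have h1 := x.val_pos
  have h2 := x.val_le
  rw [kerVec_eq (by omega), Matrix.sub_vecMul, Matrix.sub_vecMul, Matrix.add_vecMul,
    ev_vecMul_incMatrix hp hpn (by omega), ev_vecMul_incMatrix hp hpn (by omega),
    ev_vecMul_incMatrix hp hpn (by omega), ev_vecMul_incMatrix hp hpn (by omega)]
  have e1 : LeVal n p (n - 1) x.val ↔ x.val = n - 1 := by unfold LeVal; omega
  have e2 : LeVal n p n x.val ↔ x.val = n := by unfold LeVal; omega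
  have e3 : LeVal n p 1 x.val ↔ ¬ (x.val = 2 ∨ p + 1 ≤ x.val ∧ x.val ≤ n - 2) := by
    unfold LeVal; omega
  have e4 : LeVal n p 2 x.val ↔ ¬ (x.val = 1 ∨ 3 ≤ x.val ∧ x.val ≤ p) := by
    unfold LeVal; omega
  simp only [Pi.sub_apply, Pi.add_apply, e1, e2, e3, e4]
  split_ifs <;> omega

theorem kerVec_vecMul_transpose (hp : n ≤ 2 * p) (hpn : p + 2 ≤ n) :
    Matrix.vecMul (kerVec n p) (incMatrix (TwoPeak n p)).transpose = fun _ => 1 := by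
  ext x
  have h1 := x.val_pos
  have h2 := x.val_le
  rw [kerVec_eq (by omega), Matrix.sub_vecMul, Matrix.sub_vecMul, Matrix.add_vecMul,
    ev_vecMul_incMatrix_transpose hp hpn (by omega),
    ev_vecMul_incMatrix_transpose hp hpn (by omega),
    ev_vecMul_incMatrix_transpose hp hpn (by omega),
    ev_vecMul_incMatrix_transpose hp hpn (by omega)]
  have e1 : LeVal n p x.val 1 ↔ x.val = 1 := by unfold LeVal; omega
  have e2 : LeVal n p x.val 2 ↔ x.val = 2 := by unfold LeVal; omega
  have e3 : LeVal n p x.val (n - 1) ↔ x.val = 1 ∨ x.val = 2 ∨ x.val = n - 1 := by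
    unfold LeVal; omega
  have e4 : LeVal n p x.val n ↔ x.val ≠ n - 1 := by
    unfold LeVal; omega
  simp only [Pi.sub_apply, Pi.add_apply, e1, e2, e3, e4]
  split_ifs <;> omega

theorem gramMatrix_mulVec_kerVec (hp : n ≤ 2 * p) (hpn : p + 2 ≤ n) :
    (gramMatrix (TwoPeak n p)).mulVec (fun i => (kerVec n p i : ℚ)) = 0 := by
  have h : (incMatrix (TwoPeak n p) + (incMatrix (TwoPeak n p)).transpose).mulVec (kerVec n p) =
      0 := by
    rw [Matrix.add_mulVec, ← Matrix.vecMul_transpose, kerVec_vecMul_transpose hp hpn,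
      Matrix.mulVec_transpose, kerVec_vecMul hp hpn]
    ext; simp
  ext i
  have h' := congrArg (Int.cast : ℤ → ℚ) (congrFun h i)
  simp only [Matrix.mulVec, dotProduct, Int.cast_sum, Int.cast_mul] at h'
  rw [gramMatrix, Matrix.smul_mulVec, Pi.smul_apply, Matrix.mulVec, dotProduct]
  simp only [Matrix.map_apply]
  rw [h']
  simp

theorem kerVec_mul_self (x : TwoPeak n p) : (kerVec n p x = 0 ∧ x.val ≠ n - 1) ∨
    kerVec n p x * kerVec n p x = 1 := by
  unfold kerVec
  split_ifs <;> first | (right; norm_num; done) | (left; exact ⟨rfl, by omega⟩)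

theorem kerVec_el (hn : 4 ≤ n) (h : 1 ≤ n - 1 ∧ n - 1 ≤ n) :
    kerVec n p (el h) = 1 := by
  unfold kerVec
  rw [el_val, if_neg (by omega), if_pos (by omega)]

theorem structure_gram (hp : n ≤ 2 * p) (hpn : p + 2 ≤ n) :
    IsPrincipal (TwoPeak n p) ∧
      kerQ (TwoPeak n p) = (Submodule.span ℤ {kerVec n p} : Set (TwoPeak n p → ℤ)) := by
  set z : TwoPeak n p := el (k := n - 1) ⟨by omega, by omega⟩ with hz
  have hkz : kerVec n p z = 1 := kerVec_el (by omega) _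
  obtain ⟨h1, h2, h3⟩ := nonneg_of_radical (gramMatrix (TwoPeak n p)) (gramMatrix_transpose _)
    (kerVec n p) (gramMatrix_mulVec_kerVec hp hpn) (z := z) (by rw [hkz]; rfl) rfl _
    (Dynkin.posDef_gram_A (n - 1) (by omega)) (zCongruent_compl hp hpn _ rfl _)
  refine ⟨⟨h1, h2⟩, ?_⟩
  ext x
  simp only [kerQ, Set.mem_ofPred_eq, SetLike.mem_coe, Submodule.mem_span_singleton]
  have hq := quadForm_eq_gram x
  constructor
  · intro hx
    rw [hx, Int.cast_zero] at hq
    refine ⟨kerVec n p z * x z, ?_⟩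
    ext i
    have := congrFun (h3 _ hq.symm) i
    simp only [Pi.smul_apply, smul_eq_mul] at this ⊢
    exact_mod_cast this.symm
  · rintro ⟨a, rfl⟩
    have : (fun i => ((a • kerVec n p) i : ℚ)) = (a : ℚ) • fun i => (kerVec n p i : ℚ) := by
      ext i; simp
    rw [this, Matrix.mulVec_smul, gramMatrix_mulVec_kerVec hp hpn] at hq
    simpa using hq

theorem mem_kerQ_iff (hp : n ≤ 2 * p) (hpn : p + 2 ≤ n) (x : TwoPeak n p → ℤ) :
    x ∈ kerQ (TwoPeak n p) ↔ ∃ a : ℤ, a • kerVec n p = x := by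
  rw [(structure_gram hp hpn).2, SetLike.mem_coe, Submodule.mem_span_singleton]

theorem compGraph_connected (hp : n ≤ 2 * p) (hpn : p + 2 ≤ n) :
    (compGraph (TwoPeak n p)).Connected := by
  have hadj : ∀ x y : TwoPeak n p, LeVal n p x.val y.val →
      (compGraph (TwoPeak n p)).Reachable x y := by
    intro x y h
    by_cases hxy : x = y
    · rw [hxy]
    · refine SimpleGraph.Adj.reachable ?_
      rw [compGraph, SimpleGraph.fromRel_adj]
      exact ⟨hxy, Or.inl ((le_iff hp hpn x y).2 h)⟩
  set t : TwoPeak n p := el (k := n) ⟨by omega, le_rfl⟩ with ht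
  set o : TwoPeak n p := el (k := 1) ⟨le_rfl, by omega⟩ with ho
  have htop : ∀ x : TwoPeak n p, (compGraph (TwoPeak n p)).Reachable x t := by
    intro x
    have h1 := x.val_pos
    have h2 := x.val_le
    by_cases hx : x.val = n - 1
    · refine (hadj o x ?_).symm.trans (hadj o t ?_)
      · rw [ho, el_val]; unfold LeVal; omega
      · rw [ho, ht, el_val, el_val]; unfold LeVal; omega
    · exact hadj x t (by rw [ht, el_val]; unfold LeVal; omega)
  have : Nonempty (TwoPeak n p) := ⟨t⟩
  exact ⟨fun x y => (htop x).trans (htop y).symm⟩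

/-- The kernel is `ℤ h` with `h ≠ 0` and entries in `{0, 1, -1}`. Every `h^(k)` is a multiple of
`h`, so its entry `1` at `k` makes `h` a unit there; a nonzero multiple cannot then vanish at a
second element of `K`, and `K = ∅` would give a zero kernel. -/
theorem hasSpecialBasis_iff (hp : n ≤ 2 * p) (hpn : p + 2 ≤ n) (K : Finset (TwoPeak n p)) :
    HasSpecialBasis (TwoPeak n p) K ↔ ∃ k, K = {k} ∧ kerVec n p k * kerVec n p k = 1 := by
  have hne : kerVec n p ≠ 0 := fun h => by
    have := kerVec_el (n := n) (p := p) (by omega) ⟨by omega, by omega⟩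
    rw [h] at this
    exact zero_ne_one this
  constructor
  · rintro ⟨h, -, hspan, hdual⟩
    have hmem : ∀ k, ∃ a : ℤ, a • kerVec n p = h k := fun k => by
      rw [← mem_kerQ_iff hp hpn, ← hspan]
      exact Submodule.subset_span ⟨k, rfl⟩
    have hunit : ∀ k : {k // k ∈ K}, kerVec n p k.val * kerVec n p k.val = 1 := fun k => by
      obtain ⟨a, ha⟩ := hmem k
      have h1 := hdual k k
      rw [← ha, if_pos rfl] at h1
      rcases kerVec_mul_self k.val with h0 | h0
      · simp [h0.1] at h1
      · exact h0
    have hsub : ∀ k k' : {k // k ∈ K}, k = k' := fun k k' => by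
      by_contra hkk
      obtain ⟨a, ha⟩ := hmem k
      have h1 := hdual k k
      have h2 := hdual k k'
      rw [← ha, if_neg hkk, Pi.smul_apply, smul_eq_mul] at h2
      rw [← ha, if_pos rfl, Pi.smul_apply, smul_eq_mul] at h1
      rcases mul_eq_zero.1 h2 with h0 | h0
      · simp [h0] at h1
      · have := hunit k'
        simp [h0] at this
    rcases K.eq_empty_or_nonempty with rfl | ⟨k, hk⟩
    · exfalso
      have : Set.range h = ∅ := Set.range_eq_empty_iff.2 ⟨fun k => Finset.notMem_empty _ k.2⟩
      rw [this, Submodule.span_empty] at hspan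
      have h0 : kerVec n p ∈ kerQ (TwoPeak n p) := (mem_kerQ_iff hp hpn _).2 ⟨1, one_smul _ _⟩
      rw [← hspan] at h0
      exact hne (by simpa using h0)
    · refine ⟨k, ?_, hunit ⟨k, hk⟩⟩
      ext k'
      rw [Finset.mem_singleton]
      exact ⟨fun h' => congrArg Subtype.val (hsub ⟨k', h'⟩ ⟨k, hk⟩), fun h' => h' ▸ hk⟩
  · rintro ⟨k, rfl, hk⟩
    have hval : ∀ i : {i // i ∈ ({k} : Finset (TwoPeak n p))}, i.val = k := fun i =>
      Finset.mem_singleton.1 i.2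
    have : Unique {i // i ∈ ({k} : Finset (TwoPeak n p))} :=
      { default := ⟨k, Finset.mem_singleton_self k⟩, uniq := fun i => Subtype.ext (hval i) }
    have hk0 : kerVec n p k ≠ 0 := fun h => by simp [h] at hk
    refine ⟨fun _ => kerVec n p k • kerVec n p, ?_, ?_, ?_⟩
    · rw [linearIndependent_unique_iff]
      exact smul_ne_zero hk0 hne
    · rw [(structure_gram hp hpn).2, Set.range_const]
      refine congrArg _ (le_antisymm ?_ ?_)
      · rw [Submodule.span_singleton_le_iff_mem, Submodule.mem_span_singleton]
        exact ⟨_, rfl⟩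
      · rw [Submodule.span_singleton_le_iff_mem, Submodule.mem_span_singleton]
        exact ⟨kerVec n p k, by rw [smul_smul, hk, one_smul]⟩
    · intro i j
      rw [if_pos (Subsingleton.elim i j), hval j]
      exact hk

theorem isDynkinType (hp : n ≤ 2 * p) (hpn : p + 2 ≤ n) (h1 : 1 ≤ n - 1) :
    IsDynkinType (TwoPeak n p) (Dynkin.A (n - 1) h1) := by
  set z : TwoPeak n p := el (k := n - 1) ⟨by omega, by omega⟩ with hz
  have hkz : kerVec n p z * kerVec n p z = 1 := by rw [kerVec_el (by omega)]; rfl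
  have hzb : HasSpecialBasis (TwoPeak n p) {z} := (hasSpecialBasis_iff hp hpn _).2 ⟨z, rfl, hkz⟩
  have hcz := zCongruent_compl hp hpn {z} rfl h1
  refine ⟨⟨compGraph_connected hp hpn, ⟨1, (structure_gram hp hpn).1⟩, ⟨_, hzb⟩, ?_⟩, ?_⟩
  · intro K hK
    obtain ⟨k, hKk, hk⟩ := (hasSpecialBasis_iff hp hpn K).1 hK
    rw [gramMatrix_subtype]
    exact (zCongruent_submatrix_of_radical _ (gramMatrix_transpose _) _
      (gramMatrix_mulVec_kerVec hp hpn) hk hkz hKk rfl).trans hcz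
  · intro D' hD'
    have h := hD'.2.2.2 {z} hzb
    rw [gramMatrix_subtype] at h
    exact Dynkin.eq_A_of_zCongruent (by omega) h1 D' (hcz.symm.trans h)

/-! ### Action of the Coxeter matrix: two cycles and the top vector -/

/-- Multiplying by the invertible `C^tr` removes the inverse, so every image under the Coxeter
matrix can be checked by comparing indicators of up-sets and down-sets. -/
theorem vecMul_coxMatrix_of {x x' : TwoPeak n p → ℤ}
    (h : Matrix.vecMul x' (incMatrix (TwoPeak n p)).transpose =
      -Matrix.vecMul x (incMatrix (TwoPeak n p))) :
    Matrix.vecMul x (coxMatrix (TwoPeak n p)) = x' := by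
  have hu : IsUnit (incMatrix (TwoPeak n p)).transpose.det := by
    rw [Matrix.det_transpose]; exact isUnit_det_incMatrix
  rw [coxMatrix, Matrix.vecMul_neg, ← Matrix.vecMul_vecMul, ← Matrix.neg_vecMul, ← h,
    Matrix.vecMul_vecMul, Matrix.mul_nonsing_inv _ hu, Matrix.vecMul_one]

/-- The vectors, given by the arrows of the path from `1` to `n` and by the arrow from `2` to
`n - 1`, that are permuted cyclically by the Coxeter matrix. -/
def tubeL (n p i : ℕ) : TwoPeak n p → ℤ :=
  if i + 1 < p then ev n p (cyc n p (p - (i + 1))) - ev n p (cyc n p (p - i))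
  else ev n p 2 - ev n p (n - 1)

/-- The vectors, given by the arrows of the path from `2` to `n` and by the arrow from `1` to
`n - 1`, that are permuted cyclically by the Coxeter matrix. -/
def tubeR (n p j : ℕ) : TwoPeak n p → ℤ :=
  if j + 1 < n - p then ev n p (cyc n p (p + (j + 1))) - ev n p (cyc n p (p + j))
  else ev n p 1 - ev n p (n - 1)

theorem leVal_cyc_left (hp : n ≤ 2 * p) (hpn : p + 2 ≤ n) (x : ℕ) :
    LeVal n p x (cyc n p (p - 1)) ↔ x = 1 ∨ 3 ≤ x ∧ x ≤ p := by
  rcases (show 2 ≤ p by omega).eq_or_lt with rfl | h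
  · rw [show 2 - 1 = 1 from rfl, cyc_one]; unfold LeVal; omega
  · rw [cyc_up (by omega) (by omega)]; unfold LeVal; omega

theorem leVal_cyc_right (hp : n ≤ 2 * p) (hpn : p + 2 ≤ n) (x : ℕ) :
    LeVal n p x (cyc n p (p + 1)) ↔ x = 2 ∨ p + 1 ≤ x ∧ x ≤ n - 2 := by
  rcases hpn.eq_or_lt with h | h
  · rw [show p + 1 = n - 1 by omega, cyc_two (by omega) (by omega)]; unfold LeVal; omega
  · rw [cyc_down (by omega) (by omega) (by omega)]; unfold LeVal; omega

theorem leVal_one (hp : n ≤ 2 * p) (hpn : p + 2 ≤ n) (x : TwoPeak n p) :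
    LeVal n p 1 x.val ↔ ¬ (x.val = 2 ∨ p + 1 ≤ x.val ∧ x.val ≤ n - 2) := by
  have h1 := x.val_pos
  have h2 := x.val_le
  unfold LeVal; omega

theorem leVal_two (hp : n ≤ 2 * p) (hpn : p + 2 ≤ n) (x : TwoPeak n p) :
    LeVal n p 2 x.val ↔ ¬ (x.val = 1 ∨ 3 ≤ x.val ∧ x.val ≤ p) := by
  have h1 := x.val_pos
  have h2 := x.val_le
  unfold LeVal; omega

theorem leVal_to_top (hp : n ≤ 2 * p) (hpn : p + 2 ≤ n) (x : TwoPeak n p) :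
    LeVal n p x.val n ↔ x.val ≠ n - 1 := by
  have h1 := x.val_pos
  have h2 := x.val_le
  unfold LeVal; omega

theorem leVal_pred_top (hp : n ≤ 2 * p) (hpn : p + 2 ≤ n) (x : TwoPeak n p) :
    LeVal n p (n - 1) x.val ↔ x.val = n - 1 := by
  have h2 := x.val_le
  unfold LeVal; omega

theorem leVal_top (x : TwoPeak n p) : LeVal n p n x.val ↔ x.val = n := by
  have h2 := x.val_le
  exact ⟨fun h => by have := h.le; omega, fun h => Or.inl h.symm⟩

theorem leVal_to_one (x : TwoPeak n p) : LeVal n p x.val 1 ↔ x.val = 1 := by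
  have h1 := x.val_pos
  exact ⟨fun h => by have := h.le; omega, fun h => Or.inl h⟩

theorem leVal_to_two (hp : n ≤ 2 * p) (hpn : p + 2 ≤ n) (x : TwoPeak n p) : LeVal n p x.val 2 ↔ x.val = 2 := by
  have h1 := x.val_pos
  unfold LeVal; omega

theorem leVal_to_pred_top (hp : n ≤ 2 * p) (hpn : p + 2 ≤ n) (x : TwoPeak n p) :
    LeVal n p x.val (n - 1) ↔ x.val = 1 ∨ x.val = 2 ∨ x.val = n - 1 := by
  unfold LeVal; omega

/-- The extra term at `n - 1` appears only for the arrows leaving `1` or `2`. It makes the cycle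
pass from the branch over `1` to the arrow `2 → n - 1`, and from the branch over `2` to the arrow `1
→ n - 1`. -/
theorem arrow_vecMul (hp : n ≤ 2 * p) (hpn : p + 2 ≤ n) {a b : ℕ} (h : Arrow n p a b)
    (ha : 1 ≤ a) (hbn : b ≤ n) (hb : b ≠ n - 1) :
    Matrix.vecMul (ev n p a - ev n p b) (incMatrix (TwoPeak n p)) = fun x =>
      (if x.val = a then 1 else 0) + if (a = 1 ∨ a = 2) ∧ x.val = n - 1 then 1 else 0 := by
  have hab := h.1
  have hb3 : 3 ≤ b ∧ a < n - 1 := by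
    have := h.2; split_ifs at this <;> omega
  ext x
  rw [Matrix.sub_vecMul, ev_vecMul_incMatrix hp hpn (by omega),
    ev_vecMul_incMatrix hp hpn (by omega)]
  change (if LeVal n p a x.val then (1 : ℤ) else 0) - (if LeVal n p b x.val then 1 else 0) = _
  by_cases hx : x.val = n - 1
  · have e1 : LeVal n p a x.val ↔ a = 1 ∨ a = 2 := by unfold LeVal; omega
    have e2 : ¬ LeVal n p b x.val := by unfold LeVal; omega
    rw [if_neg e2, if_neg (show x.val ≠ a by omega), sub_zero, zero_add]
    exact if_congr (e1.trans (and_iff_left hx).symm) rfl rfl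
  · rw [indicator_up_sub hp hpn h hb hx, if_neg (fun h : _ ∧ x.val = n - 1 => hx h.2), add_zero]

theorem arrow_vecMul_transpose (hp : n ≤ 2 * p) (hpn : p + 2 ≤ n) {a b : ℕ} (h : Arrow n p a b)
    (ha : 1 ≤ a) (hb : b < n - 1) :
    Matrix.vecMul (ev n p a - ev n p b) (incMatrix (TwoPeak n p)).transpose = fun x =>
      -if x.val = b then 1 else 0 := by
  have hab := h.1
  ext x
  rw [Matrix.sub_vecMul, ev_vecMul_incMatrix_transpose hp hpn (by omega),
    ev_vecMul_incMatrix_transpose hp hpn (by omega), Pi.sub_apply, ← neg_sub]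
  exact congrArg _ (indicator_down_sub hp hpn h hb)

theorem tubeL_cox (hp : n ≤ 2 * p) (hpn : p + 2 ≤ n) {i : ℕ} (hi : i + 1 < p) :
    Matrix.vecMul (tubeL n p i) (coxMatrix (TwoPeak n p)) = tubeL n p (i + 1) := by
  have h := arrow_cyc_succ hpn (k := p - (i + 1)) (by omega) (by omega)
  rw [show p - (i + 1) + 1 = p - i by omega] at h
  apply vecMul_coxMatrix_of
  rw [show tubeL n p i = _ from if_pos hi, arrow_vecMul hp hpn h (cyc_mem hp hpn (by omega) (by omega)).1
    (cyc_mem hp hpn (by omega) (by omega)).2 (cyc_ne hp hpn (by omega) (by omega)), tubeL]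
  split_ifs with hi'
  · have h' := arrow_cyc_succ hpn (k := p - (i + 1 + 1)) (by omega) (by omega)
    rw [show p - (i + 1 + 1) + 1 = p - (i + 1) by omega] at h'
    have hv := cyc_up (n := n) (p := p) (k := p - (i + 1)) (by omega) (by omega)
    rw [arrow_vecMul_transpose hp hpn h' (cyc_mem hp hpn (by omega) (by omega)).1 (by omega)]
    ext x
    have : ¬ ((cyc n p (p - (i + 1)) = 1 ∨ cyc n p (p - (i + 1)) = 2) ∧ x.val = n - 1) := by omega
    rw [Pi.neg_apply, if_neg this, add_zero]
  · ext x
    rw [show p - (i + 1) = 1 by omega, cyc_one, Matrix.sub_vecMul,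
      ev_vecMul_incMatrix_transpose hp hpn (by omega),
      ev_vecMul_incMatrix_transpose hp hpn (by omega)]
    simp only [Pi.sub_apply, Pi.neg_apply, leVal_to_two hp hpn, leVal_to_pred_top hp hpn, true_or,
      true_and]
    split_ifs <;> omega

theorem tubeL_cox_last (hp : n ≤ 2 * p) (hpn : p + 2 ≤ n) :
    Matrix.vecMul (tubeL n p (p - 1)) (coxMatrix (TwoPeak n p)) = tubeL n p 0 := by
  apply vecMul_coxMatrix_of
  have hm := cyc_mem hp hpn (k := p - 1) (by omega) (by omega)
  ext x
  rw [tubeL, if_pos (by omega), tubeL, if_neg (by omega), Nat.sub_zero, cyc_top (by omega),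
    Nat.zero_add, Matrix.sub_vecMul, Matrix.sub_vecMul, ev_vecMul_incMatrix hp hpn (by omega),
    ev_vecMul_incMatrix hp hpn (by omega), ev_vecMul_incMatrix_transpose hp hpn (by omega),
    ev_vecMul_incMatrix_transpose hp hpn (by omega)]
  simp only [Pi.sub_apply, Pi.neg_apply, leVal_two hp hpn, leVal_pred_top hp hpn,
    leVal_cyc_left hp hpn, leVal_to_top hp hpn]
  split_ifs <;> omega

theorem tubeR_cox (hp : n ≤ 2 * p) (hpn : p + 2 ≤ n) {i : ℕ} (hi : i + 1 < n - p) :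
    Matrix.vecMul (tubeR n p i) (coxMatrix (TwoPeak n p)) = tubeR n p (i + 1) := by
  have h := arrow_cyc_pred (by omega) hpn (k := p + (i + 1)) (by omega) (by omega)
  rw [show p + (i + 1) - 1 = p + i by omega] at h
  apply vecMul_coxMatrix_of
  rw [show tubeR n p i = _ from if_pos hi, arrow_vecMul hp hpn h (cyc_mem hp hpn (by omega) (by omega)).1
    (cyc_mem hp hpn (by omega) (by omega)).2 (cyc_ne hp hpn (by omega) (by omega)), tubeR]
  split_ifs with hi'
  · have h' := arrow_cyc_pred (by omega) hpn (k := p + (i + 1 + 1)) (by omega) (by omega)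
    rw [show p + (i + 1 + 1) - 1 = p + (i + 1) by omega] at h'
    have hv := cyc_down (n := n) (p := p) (k := p + (i + 1)) (by omega) (by omega) (by omega)
    rw [arrow_vecMul_transpose hp hpn h' (cyc_mem hp hpn (by omega) (by omega)).1 (by omega)]
    ext x
    have : ¬ ((cyc n p (p + (i + 1)) = 1 ∨ cyc n p (p + (i + 1)) = 2) ∧ x.val = n - 1) := by omega
    rw [Pi.neg_apply, if_neg this, add_zero]
  · ext x
    rw [show p + (i + 1) = n - 1 by omega, cyc_two (by omega) hpn, Matrix.sub_vecMul,
      ev_vecMul_incMatrix_transpose hp hpn (by omega),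
      ev_vecMul_incMatrix_transpose hp hpn (by omega)]
    simp only [Pi.sub_apply, Pi.neg_apply, leVal_to_one, leVal_to_pred_top hp hpn, or_true,
      true_and]
    split_ifs <;> omega

theorem tubeR_cox_last (hp : n ≤ 2 * p) (hpn : p + 2 ≤ n) :
    Matrix.vecMul (tubeR n p (n - p - 1)) (coxMatrix (TwoPeak n p)) = tubeR n p 0 := by
  apply vecMul_coxMatrix_of
  have hm := cyc_mem hp hpn (k := p + 1) (by omega) (by omega)
  ext x
  rw [tubeR, if_pos (by omega), tubeR, if_neg (by omega), show p + 0 = p from rfl, cyc_top (by omega),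
    Nat.zero_add, Matrix.sub_vecMul, Matrix.sub_vecMul, ev_vecMul_incMatrix hp hpn (by omega),
    ev_vecMul_incMatrix hp hpn (by omega), ev_vecMul_incMatrix_transpose hp hpn (by omega),
    ev_vecMul_incMatrix_transpose hp hpn (by omega)]
  simp only [Pi.sub_apply, Pi.neg_apply, leVal_one hp hpn, leVal_pred_top hp hpn,
    leVal_cyc_right hp hpn, leVal_to_top hp hpn]
  have h1 := x.val_pos
  have h2 := x.val_le
  split_ifs <;> omega

/-- The right side is the sum of the lower covers of `n` minus `e_n`. The down-sets of these covers
partition everything except `n - 1` and `n`, so multiplying by `C^tr` leaves `-e_n`. -/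
theorem ev_top_cox (hp : n ≤ 2 * p) (hpn : p + 2 ≤ n) :
    Matrix.vecMul (ev n p n) (coxMatrix (TwoPeak n p)) =
      ev n p n + tubeL n p 0 + tubeR n p 0 := by
  apply vecMul_coxMatrix_of
  have hm := cyc_mem hp hpn (k := p + 1) (by omega) (by omega)
  have hm' := cyc_mem hp hpn (k := p - 1) (by omega) (by omega)
  ext x
  have h1 := x.val_pos
  have h2 := x.val_le
  rw [tubeL, if_pos (by omega), tubeR, if_pos (by omega), Nat.sub_zero, show p + 0 = p from rfl,
    cyc_top (by omega), Nat.zero_add, add_sub_cancel, Matrix.add_vecMul, Matrix.sub_vecMul,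
    ev_vecMul_incMatrix hp hpn (by omega), ev_vecMul_incMatrix_transpose hp hpn (by omega),
    ev_vecMul_incMatrix_transpose hp hpn (by omega),
    ev_vecMul_incMatrix_transpose hp hpn (by omega)]
  simp only [Pi.sub_apply, Pi.add_apply, Pi.neg_apply, leVal_top, leVal_cyc_left hp hpn,
    leVal_cyc_right hp hpn, leVal_to_top hp hpn]
  split_ifs <;> omega

theorem sum_tubeL (hp : n ≤ 2 * p) (hpn : p + 2 ≤ n) :
    ∑ i ∈ Finset.range p, tubeL n p i = -kerVec n p := by
  obtain ⟨r, rfl⟩ : ∃ r, p = r + 1 := ⟨p - 1, by omega⟩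
  rw [Finset.sum_range_succ]
  have : ∑ i ∈ Finset.range r, tubeL n (r + 1) i =
      ∑ i ∈ Finset.range r, (ev n (r + 1) (cyc n (r + 1) (r + 1 - (i + 1))) -
        ev n (r + 1) (cyc n (r + 1) (r + 1 - i))) :=
    Finset.sum_congr rfl fun i hi => if_pos (by have := Finset.mem_range.1 hi; omega)
  rw [this, Finset.sum_range_sub (fun i => ev n (r + 1) (cyc n (r + 1) (r + 1 - i))), tubeL,
    if_neg (by omega), show r + 1 - r = 1 by omega, cyc_one, Nat.sub_zero, cyc_top (by omega),
    kerVec_eq (by omega)]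
  abel

theorem sum_tubeR (hp : n ≤ 2 * p) (hpn : p + 2 ≤ n) :
    ∑ i ∈ Finset.range (n - p), tubeR n p i = -kerVec n p := by
  obtain ⟨r, hr⟩ : ∃ r, n - p = r + 1 := ⟨n - p - 1, by omega⟩
  rw [hr, Finset.sum_range_succ]
  have : ∑ i ∈ Finset.range r, tubeR n p i =
      ∑ i ∈ Finset.range r, (ev n p (cyc n p (p + (i + 1))) - ev n p (cyc n p (p + i))) :=
    Finset.sum_congr rfl fun i hi => if_pos (by have := Finset.mem_range.1 hi; omega)
  rw [this, Finset.sum_range_sub (fun i => ev n p (cyc n p (p + i))), tubeR,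
    if_neg (by omega), show p + r = n - 1 by omega, cyc_two (by omega) hpn, Nat.add_zero,
    cyc_top (by omega), kerVec_eq (by omega)]
  abel

theorem exists_cyc_eq (hp : n ≤ 2 * p) (hpn : p + 2 ≤ n) {x : ℕ} (h1 : 1 ≤ x) (h2 : x ≤ n)
    (h3 : x ≠ n - 1) : (∃ i < p, x = cyc n p (p - i)) ∨ ∃ j < n - p, x = cyc n p (p + j) := by
  by_cases hx1 : x = 1
  · exact Or.inl ⟨p - 1, by omega, by rw [show p - (p - 1) = 1 by omega, cyc_one, hx1]⟩
  by_cases hx2 : x = 2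
  · exact Or.inr ⟨n - 1 - p, by omega, by
      rw [show p + (n - 1 - p) = n - 1 by omega, cyc_two (by omega) hpn, hx2]⟩
  by_cases hxn : x = n
  · exact Or.inl ⟨0, by omega, by rw [Nat.sub_zero, cyc_top (by omega), hxn]⟩
  by_cases hxp : x ≤ p
  · exact Or.inl ⟨p + 1 - x, by omega, by rw [cyc_up (by omega) (by omega)]; omega⟩
  · exact Or.inr ⟨n - 1 - x, by omega, by rw [cyc_down (by omega) (by omega) (by omega)]; omega⟩

/-- Starting from `e_n`, the arrow vectors yield the unit vectors down both branches one by one, and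
the closing vector `e_1 - e_{n-1}` yields the last. -/
theorem eq_top_of_tubes_mem (hp : n ≤ 2 * p) (hpn : p + 2 ≤ n)
    (S : Submodule ℤ (TwoPeak n p → ℤ)) (h0 : ev n p n ∈ S) (hL : ∀ i < p, tubeL n p i ∈ S)
    (hR : ∀ j < n - p, tubeR n p j ∈ S) : S = ⊤ := by
  have h1 : ∀ i < p, ev n p (cyc n p (p - i)) ∈ S := by
    intro i
    induction i with
    | zero => intro _; rwa [Nat.sub_zero, cyc_top (by omega)]
    | succ i ih =>
      intro hi
      have h := hL i (by omega)
      rw [tubeL, if_pos hi] at h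
      simpa using S.add_mem h (ih (by omega))
  have h2 : ∀ j < n - p, ev n p (cyc n p (p + j)) ∈ S := by
    intro i
    induction i with
    | zero => intro _; rwa [Nat.add_zero, cyc_top (by omega)]
    | succ i ih =>
      intro hi
      have h := hR i (by omega)
      rw [tubeR, if_pos hi] at h
      simpa using S.add_mem h (ih (by omega))
  have h3 : ev n p (n - 1) ∈ S := by
    have h := hR (n - p - 1) (by omega)
    rw [tubeR, if_neg (by omega)] at h
    have h' := h1 (p - 1) (by omega)
    rw [show p - (p - 1) = 1 by omega, cyc_one] at h'
    simpa using S.sub_mem h' h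
  refine eq_top_iff.2 fun v _ => ?_
  rw [pi_eq_sum_univ' v]
  refine S.sum_mem fun x _ => S.smul_mem _ ?_
  rw [single_eq_ev]
  have hx1 := x.val_pos
  have hx2 := x.val_le
  by_cases hz : x.val = n - 1
  · rwa [hz]
  · rcases exists_cyc_eq hp hpn hx1 hx2 hz with ⟨i, hi, h⟩ | ⟨i, hi, h⟩
    · rw [h]; exact h1 i hi
    · rw [h]; exact h2 i hi

end TwoPeak

/-! ### The Coxeter polynomial -/

theorem charpoly_cyclic {m : ℕ} (hm : 0 < m) :
    (Matrix.of fun i j : Fin m => if (i.val + 1) % m = j.val then (1 : ℤ) else 0).charpoly =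
      X ^ m - 1 := by
  rw [charpoly_of_shift_rows hm _ (fun i => if i = 0 then -1 else 0)]
  · rw [Finset.sum_eq_single 0 (fun b _ hb => by simp [hb]) (fun h => by simp at h; omega)]
    simp [sub_eq_add_neg]
  · intro i h
    ext j
    simp only [Matrix.of_apply, Nat.mod_eq_of_lt h, Pi.single_apply, Fin.ext_iff, eq_comm]
  · intro j
    simp only [Matrix.of_apply, show m - 1 + 1 = m by omega, Nat.mod_self, eq_comm (a := 0)]
    split_ifs <;> simp

theorem charpoly_truncated_cyclic {m : ℕ} (hm : 0 < m) :
    (Matrix.of fun i j : Fin m =>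
      if i.val + 1 < m then (if i.val + 1 = j.val then (1 : ℤ) else 0) else -1).charpoly =
      nu (m + 1) := by
  rw [charpoly_of_shift_rows hm _ (fun _ => 1)]
  · simp [nu, Finset.sum_range_succ, add_comm]
  · intro i h
    ext j
    simp only [Matrix.of_apply, h, if_true, Pi.single_apply, Fin.ext_iff, eq_comm]
  · intro j
    simp [show m - 1 + 1 = m by omega]

/-- Surjectivity of a square integral matrix provides a one-sided inverse, which is two-sided. Hence
`A` and `K` are similar, although their index types differ. -/
theorem charpoly_eq_of_intertwining {ι κ : Type*} [Fintype ι] [DecidableEq ι] [Fintype κ]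
    [DecidableEq κ] (h : Fintype.card ι = Fintype.card κ) (F : Matrix ι κ ℤ) (A : Matrix κ κ ℤ)
    (K : Matrix ι ι ℤ) (hF : Function.Surjective F.vecMul) (hK : F * A = K * F) :
    A.charpoly = K.charpoly := by
  obtain ⟨G, hG⟩ := Matrix.vecMul_surjective_iff_exists_left_inverse.1 hF
  have hG' : F * G = 1 := (Matrix.mul_eq_one_comm_of_card_eq _ _ _ h).2 hG
  have h1 := Matrix.charpoly_mul_comm' G (K * F)
  rw [Matrix.mul_assoc, hG', Matrix.mul_one, ← hK, ← Matrix.mul_assoc, hG, Matrix.one_mul, h] at h1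
  exact (isRegular_X_pow _).left h1

namespace TwoPeak

variable {n p : ℕ}

theorem coxPoly_eq (hp : n ≤ 2 * p) (hpn : p + 2 ≤ n) :
    coxPoly (TwoPeak n p) = (X ^ p - 1) * nu (n - p) * (X - 1) := by
  obtain ⟨m, hm⟩ : ∃ m, n - p = m + 1 := ⟨n - p - 1, by omega⟩
  set F : Matrix ((Fin p ⊕ Fin m) ⊕ Unit) (TwoPeak n p) ℤ :=
    Matrix.of (Sum.elim (Sum.elim (fun i => tubeL n p i.val) fun j => tubeR n p j.val)
      fun _ => ev n p n) with hF
  set P : Matrix (Fin p) (Fin p) ℤ :=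
    Matrix.of fun i j => if (i.val + 1) % p = j.val then 1 else 0 with hP
  set N : Matrix (Fin m) (Fin m) ℤ := Matrix.of fun i j =>
    if i.val + 1 < m then (if i.val + 1 = j.val then 1 else 0) else -1 with hN
  set R : Matrix (Fin m) (Fin p) ℤ := Matrix.of fun i _ => if i.val + 1 < m then 0 else 1 with hR
  set T : Matrix Unit (Fin p ⊕ Fin m) ℤ := Matrix.of fun _ =>
    Sum.elim (fun i => if i.val = 0 then 1 else 0) (fun i => if i.val = 0 then 1 else 0) with hT
  have hcard : Fintype.card ((Fin p ⊕ Fin m) ⊕ Unit) = Fintype.card (TwoPeak n p) := by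
    rw [card_eq]; simp; omega
  -- Both cycles have sum `-h`, so the last vector of the second one is redundant; this is the
  -- source of the row of `-1`s in `N` and of the row of `1`s in `R`.
  have hlast : tubeR n p m = ∑ i : Fin p, tubeL n p i.val - ∑ j : Fin m, tubeR n p j.val := by
    have h1 := sum_tubeL hp hpn
    have h2 := sum_tubeR hp hpn
    rw [hm, Finset.sum_range_succ, ← h1] at h2
    rw [Fin.sum_univ_eq_sum_range (fun i => tubeL n p i),
      Fin.sum_univ_eq_sum_range (fun i => tubeR n p i), ← h2]
    abel
  have hsurj : Function.Surjective F.vecMul := by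
    have hrow : ∀ r, F r ∈ LinearMap.range F.vecMulLinear := fun r =>
      ⟨Pi.single r 1, Matrix.single_one_vecMul r F⟩
    have hL : ∀ i < p, tubeL n p i ∈ LinearMap.range F.vecMulLinear := fun i hi =>
      hrow (Sum.inl (Sum.inl ⟨i, hi⟩))
    have hR' : ∀ i < m, tubeR n p i ∈ LinearMap.range F.vecMulLinear := fun i hi =>
      hrow (Sum.inl (Sum.inr ⟨i, hi⟩))
    have := eq_top_of_tubes_mem hp hpn _ (hrow (Sum.inr ())) hL fun j hj => by
      rcases (show j ≤ m by omega).eq_or_lt with rfl | h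
      · rw [hlast]
        exact Submodule.sub_mem _ (Submodule.sum_mem _ fun i _ => hL i i.2)
          (Submodule.sum_mem _ fun i _ => hR' i i.2)
      · exact hR' j h
    exact LinearMap.range_eq_top.1 this
  set K : Matrix ((Fin p ⊕ Fin m) ⊕ Unit) ((Fin p ⊕ Fin m) ⊕ Unit) ℤ :=
    Matrix.fromBlocks (Matrix.fromBlocks P 0 R N) 0 T 1 with hK
  have hint : F * coxMatrix (TwoPeak n p) = K * F := by
    ext r x
    rw [Matrix.mul_apply_eq_vecMul]
    rcases r with (i | i) | u
    · have h1 : Matrix.vecMul (tubeL n p i.val) (coxMatrix (TwoPeak n p)) =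
          tubeL n p ((i.val + 1) % p) := by
        rcases (show i.val + 1 ≤ p from i.2).eq_or_lt with h | h
        · rw [h, Nat.mod_self, show i.val = p - 1 by omega, tubeL_cox_last hp hpn]
        · rw [Nat.mod_eq_of_lt h, tubeL_cox hp hpn h]
      change Matrix.vecMul (tubeL n p i.val) _ x = _
      rw [h1]
      simp only [Matrix.mul_apply, Fintype.sum_sum_type, hK, Matrix.fromBlocks_apply₁₁,
        Matrix.fromBlocks_apply₁₂, Matrix.zero_apply, zero_mul, Finset.sum_const_zero, add_zero,
        hP, hF, Matrix.of_apply, Sum.elim_inl, ite_mul, one_mul]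
      rw [Fin.sum_univ_eq_sum_range
        (fun k => if (i.val + 1) % p = k then tubeL n p k x else 0), Finset.sum_ite_eq,
        if_pos (Finset.mem_range.2 (Nat.mod_lt _ (by omega)))]
    · have h1 : Matrix.vecMul (tubeR n p i.val) (coxMatrix (TwoPeak n p)) =
          tubeR n p (i.val + 1) := tubeR_cox hp hpn (by omega)
      change Matrix.vecMul (tubeR n p i.val) _ x = _
      rw [h1]
      simp only [Matrix.mul_apply, Fintype.sum_sum_type, hK, Matrix.fromBlocks_apply₁₁,
        Matrix.fromBlocks_apply₁₂, Matrix.fromBlocks_apply₂₁, Matrix.fromBlocks_apply₂₂,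
        Matrix.zero_apply, zero_mul, Finset.sum_const_zero, add_zero,
        hR, hN, hF, Matrix.of_apply, Sum.elim_inl, Sum.elim_inr]
      rcases (show i.val + 1 ≤ m from i.2).eq_or_lt with h | h
      · rw [h, hlast]
        simp [Finset.sum_neg_distrib, sub_eq_add_neg]
      · simp only [h, if_true, zero_mul, Finset.sum_const_zero, zero_add, ite_mul, one_mul]
        rw [Fin.sum_univ_eq_sum_range
          (fun k => if i.val + 1 = k then tubeR n p k x else 0), Finset.sum_ite_eq,
          if_pos (Finset.mem_range.2 h)]
    · change Matrix.vecMul (ev n p n) _ x = _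
      rw [ev_top_cox hp hpn]
      simp only [Matrix.mul_apply, Fintype.sum_sum_type, hK, Matrix.fromBlocks_apply₂₁,
        Matrix.fromBlocks_apply₂₂, hT, hF, Matrix.of_apply, Sum.elim_inl, Sum.elim_inr,
        ite_mul, one_mul, zero_mul]
      rw [Fin.sum_univ_eq_sum_range (fun k => if k = 0 then tubeL n p k x else 0),
        Fin.sum_univ_eq_sum_range (fun k => if k = 0 then tubeR n p k x else 0),
        Finset.sum_ite_eq', Finset.sum_ite_eq', if_pos (Finset.mem_range.2 (by omega)),
        if_pos (Finset.mem_range.2 (by omega))]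
      simp
      ring
  rw [coxPoly, charpoly_eq_of_intertwining hcard F _ _ hsurj hint, hK,
    Matrix.charpoly_fromBlocks_zero₁₂, Matrix.charpoly_fromBlocks_zero₁₂, hP, hN,
    charpoly_cyclic (by omega), charpoly_truncated_cyclic (by omega), hm,
    Matrix.charpoly_one]
  simp

/-! ### Powers of the Coxeter matrix and the two Coxeter numbers -/

theorem vecMul_pow_succ (x : TwoPeak n p → ℤ) (c : ℕ) :
    Matrix.vecMul x (coxMatrix (TwoPeak n p) ^ (c + 1)) =
      Matrix.vecMul (Matrix.vecMul x (coxMatrix (TwoPeak n p) ^ c)) (coxMatrix (TwoPeak n p)) := by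
  rw [pow_succ, Matrix.vecMul_vecMul]

theorem tubeL_mod_cox (hp : n ≤ 2 * p) (hpn : p + 2 ≤ n) (i : ℕ) :
    Matrix.vecMul (tubeL n p (i % p)) (coxMatrix (TwoPeak n p)) = tubeL n p ((i + 1) % p) := by
  rw [← Nat.mod_add_mod i p 1]
  rcases (show i % p + 1 ≤ p from Nat.mod_lt _ (by omega)).eq_or_lt with h | h
  · rw [h, Nat.mod_self, show i % p = p - 1 by omega, tubeL_cox_last hp hpn]
  · rw [Nat.mod_eq_of_lt h, tubeL_cox hp hpn h]

theorem tubeR_mod_cox (hp : n ≤ 2 * p) (hpn : p + 2 ≤ n) (i : ℕ) :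
    Matrix.vecMul (tubeR n p (i % (n - p))) (coxMatrix (TwoPeak n p)) =
      tubeR n p ((i + 1) % (n - p)) := by
  rw [← Nat.mod_add_mod i (n - p) 1]
  rcases (show i % (n - p) + 1 ≤ n - p from Nat.mod_lt _ (by omega)).eq_or_lt with h | h
  · rw [h, Nat.mod_self, show i % (n - p) = n - p - 1 by omega, tubeR_cox_last hp hpn]
  · rw [Nat.mod_eq_of_lt h, tubeR_cox hp hpn h]

theorem tubeL_cox_pow (hp : n ≤ 2 * p) (hpn : p + 2 ≤ n) (i c : ℕ) :
    Matrix.vecMul (tubeL n p (i % p)) (coxMatrix (TwoPeak n p) ^ c) =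
      tubeL n p ((i + c) % p) := by
  induction c with
  | zero => simp
  | succ c ih => rw [vecMul_pow_succ, ih, tubeL_mod_cox hp hpn]; rfl

theorem tubeR_cox_pow (hp : n ≤ 2 * p) (hpn : p + 2 ≤ n) (i c : ℕ) :
    Matrix.vecMul (tubeR n p (i % (n - p))) (coxMatrix (TwoPeak n p) ^ c) =
      tubeR n p ((i + c) % (n - p)) := by
  induction c with
  | zero => simp
  | succ c ih => rw [vecMul_pow_succ, ih, tubeR_mod_cox hp hpn]; rfl

theorem ev_top_cox_pow (hp : n ≤ 2 * p) (hpn : p + 2 ≤ n) (c : ℕ) :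
    Matrix.vecMul (ev n p n) (coxMatrix (TwoPeak n p) ^ c) =
      ev n p n + ∑ i ∈ Finset.range c, tubeL n p (i % p) +
        ∑ i ∈ Finset.range c, tubeR n p (i % (n - p)) := by
  induction c with
  | zero => simp
  | succ c ih =>
    rw [pow_succ', ← Matrix.vecMul_vecMul, ev_top_cox hp hpn, Matrix.add_vecMul,
      Matrix.add_vecMul, ih]
    have h1 := tubeL_cox_pow hp hpn 0 c
    have h2 := tubeR_cox_pow hp hpn 0 c
    rw [Nat.zero_mod, Nat.zero_add] at h1 h2
    rw [h1, h2, Finset.sum_range_succ, Finset.sum_range_succ]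
    abel

theorem sum_mod_period {M : Type*} [AddCommMonoid M] (f : ℕ → M) (m k : ℕ) :
    ∑ i ∈ Finset.range (m * k), f (i % m) = k • ∑ i ∈ Finset.range m, f i := by
  induction k with
  | zero => simp
  | succ k ih =>
    rw [Nat.mul_succ, Finset.sum_range_add, ih, succ_nsmul]
    congr 1
    refine Finset.sum_congr rfl fun i hi => ?_
    rw [Nat.mul_add_mod, Nat.mod_eq_of_lt (Finset.mem_range.1 hi)]

theorem ev_top_cox_pow_period (hp : n ≤ 2 * p) (hpn : p + 2 ≤ n) {c a b : ℕ} (ha : c = p * a)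
    (hb : c = (n - p) * b) :
    Matrix.vecMul (ev n p n) (coxMatrix (TwoPeak n p) ^ c) =
      ev n p n - ((a + b : ℕ) : ℤ) • kerVec n p := by
  have h1 : ∑ i ∈ Finset.range c, tubeL n p (i % p) = -((a : ℤ) • kerVec n p) := by
    rw [ha, sum_mod_period, sum_tubeL hp hpn]; simp
  have h2 : ∑ i ∈ Finset.range c, tubeR n p (i % (n - p)) = -((b : ℤ) • kerVec n p) := by
    rw [hb, sum_mod_period, sum_tubeR hp hpn]; simp
  rw [ev_top_cox_pow hp hpn, h1, h2, Nat.cast_add, add_smul]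
  abel

theorem coxNumber_eq_top (hp : n ≤ 2 * p) (hpn : p + 2 ≤ n) :
    coxNumber (TwoPeak n p) = ⊤ := by
  have : {c : ℕ | 1 ≤ c ∧ coxMatrix (TwoPeak n p) ^ c = 1} = ∅ := by
    refine Set.eq_empty_of_forall_notMem fun c ⟨hc, h⟩ => ?_
    -- The exponent is enlarged to a common multiple of `p` and `n - p`, where `e_n` is moved by a
    -- nonzero multiple of `h`; the coordinate `n - 1` detects this.
    have h1 := ev_top_cox_pow_period hp hpn (c := c * (p * (n - p))) (a := c * (n - p))
      (b := c * p) (by ring) (by ring)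
    rw [pow_mul, h, one_pow, Matrix.vecMul_one] at h1
    have h2 := congrFun h1 (el (k := n - 1) ⟨by omega, by omega⟩)
    rw [Pi.sub_apply, Pi.smul_apply, kerVec_el (by omega)] at h2
    have h3 : 0 < c * p := Nat.mul_pos hc (by omega)
    simp only [smul_eq_mul, mul_one] at h2
    omega
  rw [coxNumber, this, Set.image_empty, sInf_empty]

/-- Because the kernel is the subgroup `ℤ h`, the condition extends from unit vectors to all
vectors, and can then be tested on the cycles. -/
theorem cox_pow_sub_one_mem_iff (hp : n ≤ 2 * p) (hpn : p + 2 ≤ n) (c : ℕ) :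
    (∀ i : TwoPeak n p, Matrix.vecMul (Pi.single i 1) (coxMatrix (TwoPeak n p) ^ c - 1) ∈
      kerQ (TwoPeak n p)) ↔
    ∀ x : TwoPeak n p → ℤ, ∃ a : ℤ, a • kerVec n p =
      Matrix.vecMul x (coxMatrix (TwoPeak n p) ^ c) - x := by
  set S : Submodule ℤ (TwoPeak n p → ℤ) := (Submodule.span ℤ {kerVec n p}).comap
    (coxMatrix (TwoPeak n p) ^ c - 1).vecMulLinear with hS
  have hmem : ∀ x, x ∈ S ↔ ∃ a : ℤ, a • kerVec n p =
      Matrix.vecMul x (coxMatrix (TwoPeak n p) ^ c) - x := fun x => by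
    rw [hS, Submodule.mem_comap, Matrix.vecMulLinear_apply, Submodule.mem_span_singleton,
      Matrix.vecMul_sub, Matrix.vecMul_one]
  constructor
  · intro h x
    rw [← hmem, pi_eq_sum_univ' x]
    refine S.sum_mem fun i _ => S.smul_mem _ ?_
    rw [hmem, ← mem_kerQ_iff hp hpn]
    have := h i
    rwa [Matrix.vecMul_sub, Matrix.vecMul_one] at this
  · intro h i
    rw [mem_kerQ_iff hp hpn, Matrix.vecMul_sub, Matrix.vecMul_one]
    exact h _

theorem exists_cox_pow_lcm (hp : n ≤ 2 * p) (hpn : p + 2 ≤ n) (x : TwoPeak n p → ℤ) :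
    ∃ a : ℤ, a • kerVec n p =
      Matrix.vecMul x (coxMatrix (TwoPeak n p) ^ Nat.lcm p (n - p)) - x := by
  set c := Nat.lcm p (n - p) with hc
  obtain ⟨a, ha⟩ : p ∣ c := Nat.dvd_lcm_left _ _
  obtain ⟨b, hb⟩ : n - p ∣ c := Nat.dvd_lcm_right _ _
  set S : Submodule ℤ (TwoPeak n p → ℤ) := (Submodule.span ℤ {kerVec n p}).comap
    (coxMatrix (TwoPeak n p) ^ c - 1).vecMulLinear with hS
  have hmem : ∀ x, x ∈ S ↔ ∃ a : ℤ, a • kerVec n p =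
      Matrix.vecMul x (coxMatrix (TwoPeak n p) ^ c) - x := fun x => by
    rw [hS, Submodule.mem_comap, Matrix.vecMulLinear_apply, Submodule.mem_span_singleton,
      Matrix.vecMul_sub, Matrix.vecMul_one]
  rw [← hmem, eq_top_of_tubes_mem hp hpn S]
  · trivial
  · rw [hmem]
    refine ⟨-((a + b : ℕ) : ℤ), ?_⟩
    rw [ev_top_cox_pow_period hp hpn ha hb, neg_smul]
    abel
  · intro i hi
    rw [hmem]
    have := tubeL_cox_pow hp hpn i c
    rw [ha, Nat.add_mul_mod_self_left, Nat.mod_eq_of_lt hi, ← ha] at this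
    exact ⟨0, by rw [this, sub_self, zero_smul]⟩
  · intro i hi
    rw [hmem]
    have := tubeR_cox_pow hp hpn i c
    rw [hb, Nat.add_mul_mod_self_left, Nat.mod_eq_of_lt hi, ← hb] at this
    exact ⟨0, by rw [this, sub_self, zero_smul]⟩

/-- The vector `h` takes the same value at `n - 1` and `n`. If `c` is not a multiple of the cycle
length, the initial vector of the cycle moves to another one, and the difference is `1` at `n` but
`0` or `-1` at `n - 1`, so it is no multiple of `h`. -/
theorem dvd_of_cox_pow (hp : n ≤ 2 * p) (hpn : p + 2 ≤ n) {c : ℕ}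
    (h : ∀ x : TwoPeak n p → ℤ, ∃ a : ℤ, a • kerVec n p =
      Matrix.vecMul x (coxMatrix (TwoPeak n p) ^ c) - x) : p ∣ c ∧ n - p ∣ c := by
  have hz : 1 ≤ n - 1 ∧ n - 1 ≤ n := by omega
  have hn : 1 ≤ n ∧ n ≤ n := by omega
  have kn : kerVec n p (el hn) = 1 := by
    unfold kerVec
    rw [el_val, if_neg (by omega), if_pos (by omega)]
  have kz : kerVec n p (el hz) = 1 := kerVec_el (by omega) _
  have hcyc : ∀ k, 1 ≤ k → k < n → cyc n p k ≠ n - 1 := fun k => cyc_ne hp hpn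
  have hcyc' : ∀ k, 1 ≤ k → k < n → k ≠ p → cyc n p k ≠ n := fun k h1 h2 h3 h4 =>
    h3 (cyc_inj hp hpn h1 h2.le (by omega) (by omega) (h4.trans (cyc_top (by omega)).symm))
  constructor
  · by_contra hc
    have hi : 0 < c % p := Nat.pos_of_ne_zero fun e => hc (Nat.dvd_of_mod_eq_zero e)
    have hip : c % p < p := Nat.mod_lt _ (by omega)
    obtain ⟨a, ha⟩ := h (tubeL n p 0)
    have := tubeL_cox_pow hp hpn 0 c
    rw [Nat.zero_mod, Nat.zero_add] at this
    rw [this] at ha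
    have h1 := congrFun ha (el hz)
    have h2 := congrFun ha (el hn)
    simp only [Pi.smul_apply, Pi.sub_apply, kn, kz, smul_eq_mul, mul_one] at h1 h2
    generalize c % p = i at *
    have e1 := hcyc (p - 1) (by omega) (by omega)
    have e2 := hcyc' (p - 1) (by omega) (by omega) (by omega)
    have e3 := cyc_top (n := n) (p := p) (by omega)
    have e4 := hcyc (p - i) (by omega) (by omega)
    have e5 := hcyc' (p - i) (by omega) (by omega) (by omega)
    rw [tubeL, tubeL, if_pos (show 0 + 1 < p by omega)] at h1 h2
    by_cases h3 : i + 1 < p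
    · have e6 := hcyc (p - (i + 1)) (by omega) (by omega)
      have e7 := hcyc' (p - (i + 1)) (by omega) (by omega) (by omega)
      simp only [h3, if_true, Pi.sub_apply, ev, el_val, Nat.zero_add, Nat.sub_zero, e3] at h1 h2
      split_ifs at h1 h2 <;> omega
    · simp only [h3, if_false, Pi.sub_apply, ev, el_val, Nat.zero_add, Nat.sub_zero, e3] at h1 h2
      split_ifs at h1 h2 <;> omega
  · by_contra hc
    have hi : 0 < c % (n - p) := Nat.pos_of_ne_zero fun e => hc (Nat.dvd_of_mod_eq_zero e)
    have hip : c % (n - p) < n - p := Nat.mod_lt _ (by omega)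
    obtain ⟨a, ha⟩ := h (tubeR n p 0)
    have := tubeR_cox_pow hp hpn 0 c
    rw [Nat.zero_mod, Nat.zero_add] at this
    rw [this] at ha
    have h1 := congrFun ha (el hz)
    have h2 := congrFun ha (el hn)
    simp only [Pi.smul_apply, Pi.sub_apply, kn, kz, smul_eq_mul, mul_one] at h1 h2
    generalize c % (n - p) = i at *
    have e1 := hcyc (p + 1) (by omega) (by omega)
    have e2 := hcyc' (p + 1) (by omega) (by omega) (by omega)
    have e3 := cyc_top (n := n) (p := p) (by omega)
    have e4 := hcyc (p + i) (by omega) (by omega)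
    have e5 := hcyc' (p + i) (by omega) (by omega) (by omega)
    rw [tubeR, tubeR, if_pos (show 0 + 1 < n - p by omega)] at h1 h2
    by_cases h3 : i + 1 < n - p
    · have e6 := hcyc (p + (i + 1)) (by omega) (by omega)
      have e7 := hcyc' (p + (i + 1)) (by omega) (by omega) (by omega)
      simp only [h3, if_true, Pi.sub_apply, ev, el_val, Nat.zero_add, Nat.add_zero, e3] at h1 h2
      split_ifs at h1 h2 <;> omega
    · simp only [h3, if_false, Pi.sub_apply, ev, el_val, Nat.zero_add, Nat.add_zero, e3] at h1 h2
      split_ifs at h1 h2 <;> omega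

theorem redCoxNumber_eq (hp : n ≤ 2 * p) (hpn : p + 2 ≤ n) :
    redCoxNumber (TwoPeak n p) = (Nat.lcm p (n - p) : ℕ∞) := by
  refine IsLeast.csInf_eq ⟨⟨_, ⟨Nat.lcm_pos (by omega) (by omega), ?_⟩, rfl⟩, ?_⟩
  · exact (cox_pow_sub_one_mem_iff hp hpn _).2 (exists_cox_pow_lcm hp hpn)
  · rintro _ ⟨c, ⟨hc, h⟩, rfl⟩
    obtain ⟨h1, h2⟩ := dvd_of_cox_pow hp hpn ((cox_pow_sub_one_mem_iff hp hpn c).1 h)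
    exact Nat.cast_le.2 (Nat.le_of_dvd hc (Nat.lcm_dvd h1 h2))

end TwoPeak

/-! ### The cycle index -/

theorem IsCyclicEnum.lt_of_lt {α : Type*} [Fintype α] [DecidableEq α] [PartialOrder α] {s : ℕ}
    {a : ℕ → α} {r : ℕ → ℕ} (h : IsCyclicEnum α s a r) {i j : ℕ} (hij : i < j) (hj : j ≤ 2 * s) :
    r i < r j := by
  induction j, hij using Nat.le_induction with
  | base => exact h.lt_succ i (by omega)
  | succ j hij ih => exact (ih (by omega)).trans (h.lt_succ j (by omega))

namespace TwoPeak

variable {n p : ℕ}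

theorem isMin_or_isMax_iff (hp : n ≤ 2 * p) (hpn : p + 2 ≤ n) (x : TwoPeak n p) :
    IsMin x ∨ IsMax x ↔ x.val = 1 ∨ x.val = 2 ∨ x.val = n - 1 ∨ x.val = n := by
  have h1 := x.val_pos
  have h2 := x.val_le
  constructor
  · intro h
    by_contra hx
    rcases h with h | h
    · by_cases hxp : x.val ≤ p
      · have := (le_iff hp hpn _ _).1 (h (b := el (k := 1) ⟨le_rfl, by omega⟩)
          ((le_iff hp hpn _ _).2 (by simp only [el_val]; unfold LeVal; omega)))
        have := this.le
        simp only [el_val] at this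
        omega
      · have := (le_iff hp hpn _ _).1 (h (b := el (k := 2) ⟨by omega, by omega⟩)
          ((le_iff hp hpn _ _).2 (by simp only [el_val]; unfold LeVal; omega)))
        have := this.le
        simp only [el_val] at this
        omega
    · have := (le_iff hp hpn _ _).1 (h (b := el (k := n) ⟨by omega, le_rfl⟩)
        ((le_iff hp hpn _ _).2 (by simp only [el_val]; unfold LeVal; omega)))
      have := this.le
      simp only [el_val] at this
      omega
  · intro h
    by_cases hx : x.val = 1 ∨ x.val = 2
    · left
      intro y hy
      rw [le_iff hp hpn] at hy ⊢
      have := y.val_pos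
      unfold LeVal at *
      omega
    · right
      intro y hy
      rw [le_iff hp hpn] at hy ⊢
      have := y.val_le
      unfold LeVal at *
      omega

theorem cyc_mem_Icc (hp : n ≤ 2 * p) (hpn : p + 2 ≤ n) (k : ℕ) :
    1 ≤ cyc n p k ∧ cyc n p k ≤ n := by
  unfold cyc
  split_ifs <;> omega

theorem exists_isCyclicEnum (hp : n ≤ 2 * p) (hpn : p + 2 ≤ n) :
    ∃ s a r, IsCyclicEnum (TwoPeak n p) s a r := by
  -- These are the positions of `1`, `n`, `2`, `n - 1` in `cyc`, followed by the closing position.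
  set r : ℕ → ℕ := fun j =>
    if j = 0 then 1 else if j = 1 then p else if j = 2 then n - 1 else if j = 3 then n else n + 1
    with hr
  have hmono : ∀ u v, LeVal n p (cyc n p u) (cyc n p v) →
      (el (cyc_mem_Icc hp hpn u) : TwoPeak n p) ≤ el (cyc_mem_Icc hp hpn v) := fun u v h =>
    (le_iff hp hpn _ _).2 h
  -- The default value of `cyc` closes the cycle at position `n + 1`.
  have hn1 : cyc n p (n + 1) = 1 := by unfold cyc; split_ifs <;> omega
  refine ⟨2, fun k => el (cyc_mem_Icc hp hpn k), r, ?_, ?_, ?_, ?_, ?_, ?_, ?_⟩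
  · rw [card_eq]
    have hinj : Set.InjOn (fun k => (el (cyc_mem_Icc hp hpn k) : TwoPeak n p)) (Set.Icc 1 n) :=
      fun k hk l hl h => cyc_inj hp hpn hk.1 hk.2 hl.1 hl.2 (congrArg Subtype.val h)
    refine ⟨fun _ _ => Set.mem_univ _, hinj, fun x _ => ?_⟩
    have : (Finset.Icc 1 n).image (fun k => (el (cyc_mem_Icc hp hpn k) : TwoPeak n p)) =
        Finset.univ := by
      apply Finset.eq_univ_of_card
      rw [Finset.card_image_of_injOn (by simpa using hinj), card_eq]
      simp
    obtain ⟨k, hk, rfl⟩ := Finset.mem_image.1 (this ▸ Finset.mem_univ x)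
    exact ⟨k, Finset.mem_Icc.1 hk, rfl⟩
  · rw [card_eq]
    exact ext_val (hn1.trans (cyc_one n p).symm)
  · rfl
  · rw [card_eq]; rfl
  · intro j hj
    rcases (show j = 0 ∨ j = 1 ∨ j = 2 ∨ j = 3 by omega) with rfl | rfl | rfl | rfl
    · exact (show 1 < p by omega)
    · exact (show p < n - 1 by omega)
    · exact (show n - 1 < n by omega)
    · exact Nat.lt_succ_self n
  · rw [card_eq]
    intro k hk
    have hs := cyc_spec n p k hp hpn hk.1 hk.2
    rw [isMin_or_isMax_iff hp hpn, el_val]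
    constructor
    · intro h
      rcases (show k = 1 ∨ k = p ∨ k = n - 1 ∨ k = n by omega) with e | e | e | e
      · exact ⟨0, by omega, e.symm⟩
      · exact ⟨1, by omega, e.symm⟩
      · exact ⟨2, by omega, e.symm⟩
      · exact ⟨3, by omega, e.symm⟩
    · rintro ⟨j, hj, h⟩
      simp only [hr] at h
      split_ifs at h <;> omega
  · intro j hj
    have hcase : j = 0 ∨ j = 1 ∨ j = 2 ∨ j = 3 := by omega
    rcases hcase with rfl | rfl | rfl | rfl
    · refine Or.inl fun u v (hu : 1 ≤ u) huv (hv : v ≤ p) => hmono u v ?_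
      have s1 := cyc_spec n p u hp hpn (by omega) (by omega)
      have s2 := cyc_spec n p v hp hpn (by omega) (by omega)
      unfold LeVal; omega
    · refine Or.inr fun u v (hu : p ≤ u) huv (hv : v ≤ n - 1) => hmono v u ?_
      have s1 := cyc_spec n p u hp hpn (by omega) (by omega)
      have s2 := cyc_spec n p v hp hpn (by omega) (by omega)
      unfold LeVal; omega
    · refine Or.inl fun u v (hu : n - 1 ≤ u) huv (hv : v ≤ n) => hmono u v ?_
      have s1 := cyc_spec n p u hp hpn (by omega) (by omega)
      have s2 := cyc_spec n p v hp hpn (by omega) (by omega)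
      unfold LeVal; omega
    · refine Or.inr fun u v (hu : n ≤ u) huv (hv : v ≤ n + 1) => hmono v u ?_
      have s1 := cyc_spec n p u hp hpn (by omega) (by omega)
      rw [show v = n + 1 by omega, hn1]
      unfold LeVal; omega

/-- The pair of end points `x`, `y` of a segment of a cyclic enumeration, with a bound for the
length of the segment. -/
def SegmentType (n p x y l : ℕ) : Prop :=
  (((x = 1 ∧ y = n) ∨ (x = n ∧ y = 1)) ∧ l + 1 ≤ p) ∨
  (((x = 2 ∧ y = n) ∨ (x = n ∧ y = 2)) ∧ l + 1 ≤ n - p) ∨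
  (((x = 1 ∧ y = n - 1) ∨ (x = n - 1 ∧ y = 1)) ∧ l ≤ 1) ∨
  (((x = 2 ∧ y = n - 1) ∨ (x = n - 1 ∧ y = 2)) ∧ l ≤ 1)

theorem SegmentType.symm {x y l : ℕ} (h : SegmentType n p x y l) : SegmentType n p y x l := by
  rcases h with ⟨h, h'⟩ | ⟨h, h'⟩ | ⟨h, h'⟩ | ⟨h, h'⟩
  · exact Or.inl ⟨by omega, h'⟩
  · exact Or.inr (Or.inl ⟨by omega, h'⟩)
  · exact Or.inr (Or.inr (Or.inl ⟨by omega, h'⟩))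
  · exact Or.inr (Or.inr (Or.inr ⟨by omega, h'⟩))

/-- The end points run once around `1, n, 2, n - 1`, so each length bound occurs once. The bounds
add up to `n` and are therefore attained; opposite segments give `(p - 1) + 1` and `(n - p - 1) +
1`, and `n - p ≤ p`. -/
theorem max_eq_of_segmentType (hp : n ≤ 2 * p) (hpn : p + 2 ≤ n)
    {w₀ w₁ w₂ w₃ l₀ l₁ l₂ l₃ : ℕ} (h02 : w₀ ≠ w₂) (h13 : w₁ ≠ w₃)
    (h0 : SegmentType n p w₀ w₁ l₀) (h1 : SegmentType n p w₁ w₂ l₁)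
    (h2 : SegmentType n p w₂ w₃ l₂) (h3 : SegmentType n p w₃ w₀ l₃)
    (hl : l₀ + l₁ + l₂ + l₃ = n) : max (l₀ + l₂) (l₁ + l₃) = p := by
  unfold SegmentType at h0 h1 h2 h3
  rcases h0 with ⟨h0 | h0, _⟩ | ⟨h0 | h0, _⟩ | ⟨h0 | h0, _⟩ | ⟨h0 | h0, _⟩ <;>
  rcases h1 with ⟨h1 | h1, _⟩ | ⟨h1 | h1, _⟩ | ⟨h1 | h1, _⟩ | ⟨h1 | h1, _⟩ <;>
  first | (exfalso; omega) |
  (rcases h2 with ⟨h2 | h2, _⟩ | ⟨h2 | h2, _⟩ | ⟨h2 | h2, _⟩ | ⟨h2 | h2, _⟩ <;>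
   first | (exfalso; omega) |
   (rcases h3 with ⟨h3 | h3, _⟩ | ⟨h3 | h3, _⟩ | ⟨h3 | h3, _⟩ | ⟨h3 | h3, _⟩ <;> omega))

/-- Interior elements of an increasing segment are non-extremal and lie between its ends, hence
inside one branch of the cycle; injectivity turns the size of that branch into a bound for the
length. -/
theorem segmentType_of_chain (hp : n ≤ 2 * p) (hpn : p + 2 ≤ n) {b : ℕ → ℕ} {u v : ℕ}
    (huv : u < v) (hinj : Set.InjOn b (Set.Ioo u v)) (hne : b u ≠ b v)
    (hu : b u = 1 ∨ b u = 2 ∨ b u = n - 1 ∨ b u = n)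
    (hv : b v = 1 ∨ b v = 2 ∨ b v = n - 1 ∨ b v = n)
    (hint : ∀ k, u < k → k < v → b k ≠ 1 ∧ b k ≠ 2 ∧ b k ≠ n - 1 ∧ b k ≠ n)
    (hle : ∀ k l, u ≤ k → k < l → l ≤ v → LeVal n p (b k) (b l)) :
    SegmentType n p (b u) (b v) (v - u) := by
  have hbd : ∀ c d, (∀ k, u < k → k < v → c ≤ b k ∧ b k ≤ d) → v - u - 1 ≤ d + 1 - c := by
    intro c d h
    rw [← Nat.card_Ioo, ← Nat.card_Icc]
    exact Finset.card_le_card_of_injOn b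
      (fun k hk => by
        have := Finset.mem_Ioo.1 hk
        exact Finset.mem_coe.2 (Finset.mem_Icc.2 (h k this.1 this.2)))
      (by simpa using hinj)
  have h0 := hle u v le_rfl huv le_rfl
  have hk : ∀ k, u < k → k < v → LeVal n p (b u) (b k) ∧ LeVal n p (b k) (b v) :=
    fun k h1 h2 => ⟨hle u k le_rfl h1 h2.le, hle k v h1.le h2 le_rfl⟩
  have hcase : (b u = 1 ∧ b v = n) ∨ (b u = 2 ∧ b v = n) ∨ (b u = 1 ∧ b v = n - 1) ∨
      (b u = 2 ∧ b v = n - 1) := by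
    unfold LeVal at h0
    omega
  unfold LeVal at hk
  rcases hcase with ⟨e1, e2⟩ | ⟨e1, e2⟩ | ⟨e1, e2⟩ | ⟨e1, e2⟩ <;> rw [e1, e2] at hk ⊢
  · have := hbd 3 p fun k h1 h2 => by
      have := hk k h1 h2
      have := hint k h1 h2
      omega
    exact Or.inl ⟨by omega, by omega⟩
  · have := hbd (p + 1) (n - 2) fun k h1 h2 => by
      have := hk k h1 h2
      have := hint k h1 h2
      omega
    exact Or.inr (Or.inl ⟨by omega, by omega⟩)
  -- Nothing lies strictly between a minimal element and `n - 1`; the empty interval from `1` to `0`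
  -- expresses this.
  · have := hbd 1 0 fun k h1 h2 => by
      have := hk k h1 h2
      have := hint k h1 h2
      omega
    exact Or.inr (Or.inr (Or.inl ⟨by omega, by omega⟩))
  · have := hbd 1 0 fun k h1 h2 => by
      have := hk k h1 h2
      have := hint k h1 h2
      omega
    exact Or.inr (Or.inr (Or.inr ⟨by omega, by omega⟩))

theorem segmentType_of_chain' (hp : n ≤ 2 * p) (hpn : p + 2 ≤ n) {b : ℕ → ℕ} {u v : ℕ}
    (huv : u < v) (hinj : Set.InjOn b (Set.Ioo u v)) (hne : b u ≠ b v)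
    (hu : b u = 1 ∨ b u = 2 ∨ b u = n - 1 ∨ b u = n)
    (hv : b v = 1 ∨ b v = 2 ∨ b v = n - 1 ∨ b v = n)
    (hint : ∀ k, u < k → k < v → b k ≠ 1 ∧ b k ≠ 2 ∧ b k ≠ n - 1 ∧ b k ≠ n)
    (hle : ∀ k l, u ≤ k → k < l → l ≤ v → LeVal n p (b l) (b k)) :
    SegmentType n p (b u) (b v) (v - u) := by
  -- Reversing the segment by `k ↦ u + v - k` makes it increasing.
  have key := segmentType_of_chain hp hpn (b := fun k => b (u + v - k)) huv
    (fun k hk l hl h => by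
      obtain ⟨h1, h2⟩ := hk
      obtain ⟨h3, h4⟩ := hl
      have := hinj (show u + v - k ∈ Set.Ioo u v from ⟨by omega, by omega⟩)
        (show u + v - l ∈ Set.Ioo u v from ⟨by omega, by omega⟩) h
      omega)
    (by simpa using hne.symm) (by simpa using hv) (by simpa using hu)
    (fun k h1 h2 => hint _ (by omega) (by omega))
    (fun k l h1 h2 h3 => hle _ _ (by omega) (by omega) (by omega))
  simp only [Nat.add_sub_cancel, Nat.add_sub_cancel_left] at key
  exact key.symm

/-- The `2 s` break points correspond bijectively to the four extremal elements. -/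
theorem eq_two_of_isCyclicEnum (hp : n ≤ 2 * p) (hpn : p + 2 ≤ n) {s : ℕ} {a : ℕ → TwoPeak n p}
    {r : ℕ → ℕ} (h : IsCyclicEnum (TwoPeak n p) s a r) : s = 2 := by
  have hb := h.bijOn
  have hl := h.last
  have hex := h.extremal
  rw [card_eq] at hb hl hex
  have hmem : ∀ j < 2 * s, r j ∈ Set.Icc 1 n := fun j hj => by
    have h1 := h.lt_of_lt hj le_rfl
    have h2 : 1 ≤ r j := by
      rw [← h.first]
      rcases Nat.eq_zero_or_pos j with rfl | h0
      · exact le_rfl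
      · exact (h.lt_of_lt h0 hj.le).le
    exact ⟨h2, by omega⟩
  have hinj : Set.InjOn (fun j => (a (r j)).val) (Finset.range (2 * s)) := by
    intro i hi j hj hij
    have hi' := Finset.mem_range.1 (Finset.mem_coe.1 hi)
    have hj' := Finset.mem_range.1 (Finset.mem_coe.1 hj)
    have e := hb.injOn (hmem i hi') (hmem j hj') (ext_val hij)
    rcases lt_trichotomy i j with hlt | hlt | hlt
    · have := h.lt_of_lt hlt hj'.le; omega
    · exact hlt
    · have := h.lt_of_lt hlt hi'.le; omega
  have himg : (Finset.range (2 * s)).image (fun j => (a (r j)).val) = {1, 2, n - 1, n} := by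
    ext x
    simp only [Finset.mem_image, Finset.mem_range, Finset.mem_insert, Finset.mem_singleton]
    constructor
    · rintro ⟨j, hj, rfl⟩
      exact (isMin_or_isMax_iff hp hpn _).1 ((hex _ (hmem j hj)).2 ⟨j, hj, rfl⟩)
    · intro hx
      obtain ⟨k, hk, e⟩ := hb.surjOn (Set.mem_univ (el (k := x) ⟨by omega, by omega⟩))
      have e' : (a k).val = x := by rw [e, el_val]
      obtain ⟨j, hj, rfl⟩ := (hex k hk).1 ((isMin_or_isMax_iff hp hpn _).2 (by rwa [e']))
      exact ⟨j, hj, e'⟩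
  have hcard := Finset.card_image_of_injOn hinj
  rw [himg, Finset.card_range, Finset.card_insert_of_notMem (by simp; omega),
    Finset.card_insert_of_notMem (by simp; omega), Finset.card_insert_of_notMem (by simp; omega),
    Finset.card_singleton] at hcard
  omega

theorem enumValue_eq (hp : n ≤ 2 * p) (hpn : p + 2 ≤ n) {s : ℕ} {a : ℕ → TwoPeak n p}
    {r : ℕ → ℕ} (h : IsCyclicEnum (TwoPeak n p) s a r) : enumValue s a r = p := by
  obtain rfl := eq_two_of_isCyclicEnum hp hpn h
  have hb := h.bijOn
  have hl := h.last
  have hw := h.wrap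
  have hex := h.extremal
  rw [card_eq] at hb hl hex hw
  norm_num at hl
  have hf := h.first
  have l0 := h.lt_succ 0 (by omega)
  have l1 := h.lt_succ 1 (by omega)
  have l2 := h.lt_succ 2 (by omega)
  have l3 := h.lt_succ 3 (by omega)
  norm_num at l0 l1 l2 l3
  -- Positions `1` and `n + 1` carry the same element; the last alternative says that no single
  -- segment contains both, so the enumeration is injective on each segment.
  have hrj : ∀ j < 4, 1 ≤ r j ∧ r (j + 1) ≤ n + 1 ∧ (1 < r j ∨ r (j + 1) ≤ n) := by
    intro j hj
    rcases (show j = 0 ∨ j = 1 ∨ j = 2 ∨ j = 3 by omega) with rfl | rfl | rfl | rfl <;> norm_num <;>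
      omega
  have hinj : ∀ u v, 1 ≤ u → u < v → v ≤ n + 1 → (1 < u ∨ v ≤ n) → a u ≠ a v := by
    intro u v h1 h2 h3 h4 e
    rcases h3.eq_or_lt with rfl | h3
    · rw [hw] at e
      have := hb.injOn ⟨h1, by omega⟩ ⟨le_rfl, by omega⟩ e
      omega
    · have := hb.injOn ⟨h1, by omega⟩ ⟨by omega, by omega⟩ e
      omega
  have hend : ∀ j ≤ 4, (a (r j)).val = 1 ∨ (a (r j)).val = 2 ∨ (a (r j)).val = n - 1 ∨
      (a (r j)).val = n := by
    intro j hj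
    rw [← isMin_or_isMax_iff hp hpn]
    rcases hj.eq_or_lt with rfl | hj
    · rw [hl, hw]
      exact (hex 1 ⟨le_rfl, by omega⟩).2 ⟨0, by omega, hf⟩
    · have := hrj j hj
      have := h.lt_succ j hj
      exact (hex _ ⟨by omega, by omega⟩).2 ⟨j, hj, rfl⟩
  have hlt : ∀ i j, i < j → j ≤ 4 → r i < r j := fun i j hij hj => h.lt_of_lt hij hj
  have hseg : ∀ j < 4, SegmentType n p (a (r j)).val (a (r (j + 1))).val (r (j + 1) - r j) ∧
      (segment a r j).card = r (j + 1) - r j + 1 := by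
    intro j hj
    obtain ⟨h1, h2, h3⟩ := hrj j hj
    have h4 := h.lt_succ j hj
    have hI : Set.InjOn a (Set.Icc (r j) (r (j + 1))) := by
      intro k hk l hl' e
      have hk1 := hk.1
      have hk2 := hk.2
      have hl1 := hl'.1
      have hl2 := hl'.2
      rcases lt_trichotomy k l with g | g | g
      · exact absurd e (hinj k l (by omega) g (by omega) (by omega))
      · exact g
      · exact absurd e.symm (hinj l k (by omega) g (by omega) (by omega))
    have hI' : Set.InjOn (fun k => (a k).val) (Set.Ioo (r j) (r (j + 1))) := fun k hk l hl' e =>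
      hI (Set.Ioo_subset_Icc_self hk) (Set.Ioo_subset_Icc_self hl') (ext_val e)
    have hne : (a (r j)).val ≠ (a (r (j + 1))).val := fun e =>
      hinj _ _ h1 h4 h2 h3 (ext_val e)
    have hint : ∀ k, r j < k → k < r (j + 1) → (a k).val ≠ 1 ∧ (a k).val ≠ 2 ∧
        (a k).val ≠ n - 1 ∧ (a k).val ≠ n := by
      intro k hk1 hk2
      have : ¬ (IsMin (a k) ∨ IsMax (a k)) := by
        rw [hex k ⟨by omega, by omega⟩]
        rintro ⟨i, hi, rfl⟩
        rcases lt_trichotomy i j with g | g | g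
        · have := hlt i j g (by omega); omega
        · subst g; omega
        · rcases (show j + 1 ≤ i from g).eq_or_lt with g | g
          · subst g; omega
          · have := hlt (j + 1) i g (by omega); omega
      rw [isMin_or_isMax_iff hp hpn] at this
      omega
    constructor
    · rcases h.monotone j hj with hm | hm
      · exact segmentType_of_chain hp hpn (b := fun k => (a k).val) h4 hI' hne (hend j hj.le)
          (hend _ hj) hint fun k l g1 g2 g3 => (le_iff hp hpn _ _).1 (hm k l g1 g2 g3)
      · exact segmentType_of_chain' hp hpn (b := fun k => (a k).val) h4 hI' hne (hend j hj.le)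
          (hend _ hj) hint fun k l g1 g2 g3 => (le_iff hp hpn _ _).1 (hm k l g1 g2 g3)
    · rw [segment, Finset.card_image_of_injOn (by simpa using hI), Nat.card_Icc]
      omega
  obtain ⟨t0, c0⟩ := hseg 0 (by omega)
  obtain ⟨t1, c1⟩ := hseg 1 (by omega)
  obtain ⟨t2, c2⟩ := hseg 2 (by omega)
  obtain ⟨t3, c3⟩ := hseg 3 (by omega)
  norm_num at t0 t1 t2 t3 c0 c1 c2 c3
  have h02 : (a (r 0)).val ≠ (a (r 2)).val := fun e =>
    hinj _ _ (by omega) (hlt 0 2 (by omega) (by omega)) (by omega) (by omega) (ext_val e)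
  have h13 : (a (r 1)).val ≠ (a (r 3)).val := fun e =>
    hinj _ _ (by omega) (hlt 1 3 (by omega) (by omega)) (by omega) (by omega) (ext_val e)
  have hw' : a (r 4) = a (r 0) := by rw [hl, hw, hf]
  rw [hw'] at t3
  have := max_eq_of_segmentType hp hpn h02 h13 t0 t1 t2 t3 (by omega)
  -- A segment has one element more than its length, so subtracting `s = 2` turns each sum of two
  -- cardinalities into a sum of lengths.
  simp only [enumValue, Finset.sum_range_succ, Finset.sum_range_zero, zero_add, mul_zero,
    Nat.reduceAdd, mul_one, c0, c1, c2, c3]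
  omega

theorem isCycleIndex (hp : n ≤ 2 * p) (hpn : p + 2 ≤ n) : IsCycleIndex (TwoPeak n p) p :=
  ⟨exists_isCyclicEnum hp hpn, fun _ _ _ h => enumValue_eq hp hpn h⟩

end TwoPeak

theorem X_sub_one_mul_nu (m : ℕ) : (X - 1) * nu m = X ^ m - 1 := mul_geom_sum X m

end CoxeterPoset

theorem lemma4p2 (n p : ℕ) (hn : 4 ≤ n) (hp : n ≤ 2 * p) (hpn : p ≤ n - 2) :
    (CoxeterPoset.IsPrincipal (CoxeterPoset.TwoPeak n p) ∧
      CoxeterPoset.IsDynkinType (CoxeterPoset.TwoPeak n p)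
        (CoxeterPoset.Dynkin.A (n - 1) (Nat.le_sub_one_of_lt (by omega))) ∧
      CoxeterPoset.kerQ (CoxeterPoset.TwoPeak n p) =
        (Submodule.span ℤ {CoxeterPoset.TwoPeak.kerVec n p} :
          Set (CoxeterPoset.TwoPeak n p → ℤ))) ∧
    (CoxeterPoset.coxPoly (CoxeterPoset.TwoPeak n p) =
        X ^ n - X ^ p - X ^ (n - p) + 1 ∧
      CoxeterPoset.coxPoly (CoxeterPoset.TwoPeak n p) =
        (X - 1) ^ 2 * CoxeterPoset.nu p * CoxeterPoset.nu (n - p)) ∧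
    (CoxeterPoset.coxNumber (CoxeterPoset.TwoPeak n p) = ⊤ ∧
      CoxeterPoset.redCoxNumber (CoxeterPoset.TwoPeak n p) = (Nat.lcm p (n - p) : ℕ∞)) ∧
    CoxeterPoset.IsCycleIndex (CoxeterPoset.TwoPeak n p) p := by
  have hpn' : p + 2 ≤ n := by omega
  have hg := CoxeterPoset.TwoPeak.structure_gram hp hpn'
  have hc := CoxeterPoset.TwoPeak.coxPoly_eq hp hpn'
  have hn1 : (X : ℤ[X]) ^ n = X ^ p * X ^ (n - p) := by rw [← pow_add]; congr 1; omega
  have h1 := CoxeterPoset.X_sub_one_mul_nu p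
  have h2 := CoxeterPoset.X_sub_one_mul_nu (n - p)
  refine ⟨⟨hg.1, CoxeterPoset.TwoPeak.isDynkinType hp hpn' _, hg.2⟩, ⟨?_, ?_⟩,
    ⟨CoxeterPoset.TwoPeak.coxNumber_eq_top hp hpn', CoxeterPoset.TwoPeak.redCoxNumber_eq hp hpn'⟩,
    CoxeterPoset.TwoPeak.isCycleIndex hp hpn'⟩
  · rw [hc, hn1]
    linear_combination (X ^ p - 1) * h2
  · rw [hc, ← h1]
    ring
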